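/- **Setting.** Let $n\ge 1$ and let $K\subset\mathbb{R}^n$ be compact and convex, containing the closed Euclidean ball of radius $r>0$ around a point $p$. At each round $t=1,2,\dots$ an agent plays an action $\hat X_t\in K$ and earns $u_t(\hat X_t)$; this reward is revealed to the agent at round $t+d_t$, where $d_t\in\{0,1,2,\dots\}$. The sequences $(u_t)$ and $(d_t)$ are fixed in advance (they do not depend on the agent's randomness). The functions $u_t:K\to\mathbb{R}$ are concave and differentiable and satisfy, with constants $V,\beta,M$ independent of $t$, $\|\nabla u_t(x)\|\le V$, $\|\nabla u_t(x')-\nabla u_t(x)\|\le\beta\|x'-x\|$ and $|u_t(x)|\le M$ for all $x,x'\in K$. The delays satisfy $d_t=o(t^{\alpha})$ as $t\to\infty$ for some real $\alpha<1$. **The policy (GOLD).** Let $\gamma>0$, $0<\delta\le r$, and $$\gamma_t=\frac{\gamma}{t^{c}},\qquad \delta_t=\frac{\delta}{t^{b}},\qquad b=\min\{\tfrac14,\tfrac13-\tfrac{\alpha}{3}\},\qquad c=\max\{\tfrac34,\tfrac23+\tfrac{\alpha}{3}\}.$$ Start from $X_1\in K$ and the empty pool $\mathcal P_0=\varnothing$.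 At round $t=1,2,\dots$, draw $U_t$ uniformly from the unit sphere of $\mathbb{R}^n$, independently across rounds, and play $$\hat X_t=X_t+\delta_t\Bigl(U_t-\frac{X_t-p}{r}\Bigr).$$ Collect the rewards of the rounds $\mathcal R_t=\{s\ge 1: s+d_s=t\}$, let $q_t=\min(\mathcal P_{t-1}\cup\mathcal R_t)$ (with $q_t=\infty$ if this set is empty), and put $\mathcal P_t=(\mathcal P_{t-1}\cup\mathcal R_t)\setminus\{q_t\}$. Finally, update $$X_{t+1}=\operatorname{Proj}_K\bigl(X_t+\gamma_t\hat v_t\bigr),\qquad \hat v_t=\frac{n}{\delta_{q_t}}\,u_{q_t}(\hat X_{q_t})\,U_{q_t}\ \text{ if } q_t<\infty,\qquad \hat v_t=0\ \text{ if } q_t=\infty,$$ where $\operatorname{Proj}_K$ is the Euclidean projection onto $K$. **Theorem.** The mean (pseudo-)regret $$\overline{\mathrm{Reg}}(T)=\max_{x\in K}\ \mathbb{E}\Bigl[\sum_{t=1}^{T}\bigl(u_t(x)-u_t(\hat X_t)\bigr)\Bigr]$$ of the agent satisfies $\overline{\mathrm{Reg}}(T)\le\tilde O\bigl(T^{3/4}+T^{2/3+\alpha/3}\bigr)$;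 that is, there are constants $C$ and $k\in\mathbb{N}$ such that, for all $T\ge1$, $$\overline{\mathrm{Reg}}(T)\le C\,(1+\log T)^{k}\,\bigl(T^{3/4}+T^{2/3+\alpha/3}\bigr).$$ The expectations exist, the maximum is attained, and all this holds also with the pivots $X_t$ in place of the played actions $\hat X_t$. The constants $C$ and $k$ depend only on $n$, $r$, $V$, $\beta$, $M$, $\gamma$, $\delta$, $\alpha$, the delay sequence $(d_t)$ and an upper bound on the diameter of $K$. -/

import Mathlib

open MeasureTheory ProbabilityTheory Filter Asymptotics Metric

noncomputable section

/-- The ambient space `ℝⁿ` with its Euclidean norm. -/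
abbrev Euc (n : ℕ) : Type := EuclideanSpace ℝ (Fin n)

/-- The unit sphere of `ℝⁿ`. -/
abbrev UnitSphere (n : ℕ) : Type := sphere (0 : Euc n) 1

/-- The uniform distribution on the unit sphere: normalized surface measure. -/
def uniformSphere (n : ℕ) : Measure (UnitSphere n) :=
  ((volume : Measure (Euc n)).toSphere Set.univ)⁻¹ • (volume : Measure (Euc n)).toSphere

/-- `z` is a minimizer of the distance to `y` over `K`. -/
def IsNearestPoint {n : ℕ} (K : Set (Euc n)) (y z : Euc n) : Prop :=
  z ∈ K ∧ ∀ w ∈ K, ‖z - y‖ ≤ ‖w - y‖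

/-- The Euclidean projection `argmin_{z ∈ K} ‖z - y‖`. -/
def euclProj {n : ℕ} (K : Set (Euc n)) (y : Euc n) : Euc n :=
  Classical.epsilon (IsNearestPoint K y)

/-- The projection is well defined on compact convex sets: it is the unique nearest point. -/
theorem isNearestPoint_iff_eq_euclProj {n : ℕ} {K : Set (Euc n)} (hK : IsCompact K)
    (hc : Convex ℝ K) (hne : K.Nonempty) (y z : Euc n) :
    IsNearestPoint K y z ↔ z = euclProj K y := by
  have hex : ∃ z, IsNearestPoint K y z := by
    obtain ⟨z, hz, h⟩ := hK.exists_isMinOn hne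
      (f := fun z => ‖z - y‖) (by fun_prop)
    exact ⟨z, hz, fun w hw => h hw⟩
  have hspec : IsNearestPoint K y (euclProj K y) := Classical.epsilon_spec hex
  have key : ∀ v, IsNearestPoint K y v → ∀ w ∈ K, inner ℝ (y - v) (w - v) ≤ 0 := by
    intro v hv
    refine (norm_eq_iInf_iff_real_inner_le_zero hc hv.1).1 ?_
    have : Nonempty K := ⟨⟨v, hv.1⟩⟩
    refine le_antisymm (le_ciInf fun w => ?_) (ciInf_le ⟨0, ?_⟩ (⟨v, hv.1⟩ : K))
    · rw [norm_sub_rev y v, norm_sub_rev y w]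
      exact hv.2 w w.2
    · rintro _ ⟨w, rfl⟩
      exact norm_nonneg _
  refine ⟨fun hz => ?_, fun h => h ▸ hspec⟩
  set v := euclProj K y
  have h1 := key z hz v hspec.1
  have h2 := key v hspec z hz.1
  have h3 : inner ℝ (z - v) (z - v) ≤ 0 := by
    have e : inner ℝ (z - v) (z - v)
        = inner ℝ (y - z) (v - z) + inner ℝ (y - v) (z - v) := by
      have e1 : inner ℝ (y - z) (v - z) = - inner ℝ (y - z) (z - v) := by
        rw [← inner_neg_right, neg_sub]
      rw [e1, neg_add_eq_sub, ← inner_sub_left]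
      congr 1
      abel
    linarith
  rw [real_inner_self_eq_norm_sq] at h3
  have h4 : ‖z - v‖ = 0 := by nlinarith [norm_nonneg (z - v)]
  exact sub_eq_zero.1 (norm_eq_zero.1 h4)

/-! ### The delayed-feedback queue

Rounds are numbered `1, 2, 3, …`; the values of all sequences at index `0` are never used. -/

/-- The rounds whose reward is received at round `t`. -/
def received (d : ℕ → ℕ) (t : ℕ) : Finset ℕ :=
  (Finset.Icc 1 t).filter (fun s => s + d s = t)

/-- The pool left over at the end of round `t`: initially empty; at each round the newly received
rewards are added and the oldest element of the resulting pool (if there is one) is removed. -/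
def pool (d : ℕ → ℕ) : ℕ → Finset ℕ
  | 0 => ∅
  | t + 1 => (pool d t ∪ received d (t + 1)).filter
      (fun s => (s : WithTop ℕ) ≠ (pool d t ∪ received d (t + 1)).min)

/-- The round whose reward is dequeued at round `t ≥ 1`: the oldest element of the pool, and
`⊤` (that is, `∞`) if the pool is empty. -/
def head (d : ℕ → ℕ) (t : ℕ) : WithTop ℕ :=
  (pool d (t - 1) ∪ received d t).min

/-! ### The policy -/

/-- The data on which the policy runs: action set `K`, safety ball of radius `r` and center `p`,
initial pivot, payoff functions, delays, step sizes and sampling radii. -/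
structure GoldData (n : ℕ) where
  K : Set (Euc n)
  p : Euc n
  r : ℝ
  init : Euc n
  payoff : ℕ → Euc n → ℝ
  delay : ℕ → ℕ
  step : ℕ → ℝ
  radius : ℕ → ℝ

namespace GoldData

variable {n : ℕ} (G : GoldData n)

/-- The action played at round `t` from pivot `x` with sampling direction `w`, namely
`x + δ_t (w - (x - p) / r)`. -/
def action (t : ℕ) (x w : Euc n) : Euc n :=
  x + G.radius t • (w - G.r⁻¹ • (x - G.p))

/-- The one-point gradient estimate of round `t` from pivot `x` with direction `w`, namely
`(n / δ_t) u_t(x̂_t) w`. -/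
def estimate (t : ℕ) (x w : Euc n) : Euc n :=
  ((n : ℝ) / G.radius t * G.payoff t (G.action t x w)) • w

/-- The policy run along a sequence `w` of sampling directions. `G.run w t` consists of the pivot
after `t` rounds and of the table of the gradient estimates of rounds `1, …, t`. At round `t + 1`
the estimate of that round is recorded, and the pivot is moved along the estimate of the dequeued
round (it does not move if nothing is dequeued: the estimate used is then `0`). Only entries whose
reward has been received are ever read. -/
def run (w : ℕ → Euc n) : ℕ → Euc n × (ℕ → Euc n)
  | 0 => (G.init, fun _ => 0)
  | t + 1 =>
    let x := (run w t).1
    let table := Function.update (run w t).2 (t + 1) (G.estimate (t + 1) x (w (t + 1)))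
    let v : Euc n := WithTop.recTopCoe 0 table (head G.delay (t + 1))
    (euclProj G.K (x + G.step (t + 1) • v), table)

/-- The pivot `X_t` of round `t ≥ 1`. -/
def pivot (w : ℕ → Euc n) (t : ℕ) : Euc n := (G.run w (t - 1)).1

/-- The action `X̂_t` played at round `t ≥ 1`. -/
def played (w : ℕ → Euc n) (t : ℕ) : Euc n := G.action t (G.pivot w t) (w t)

/-- The gradient estimate used at round `t`: the one of the dequeued round, or `0` if nothing is
dequeued. -/
def usedEstimate (w : ℕ → Euc n) (t : ℕ) : Euc n :=
  WithTop.recTopCoe (0 : Euc n)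
    (fun s : ℕ => ((n : ℝ) / G.radius s * G.payoff s (G.played w s)) • w s) (head G.delay t)

theorem pivot_one (w : ℕ → Euc n) : G.pivot w 1 = G.init := rfl

theorem run_table (w : ℕ → Euc n) (t s : ℕ) (h1 : 1 ≤ s) (hs : s ≤ t) :
    (G.run w t).2 s = G.estimate s (G.pivot w s) (w s) := by
  induction t with
  | zero => omega
  | succ t ih =>
    rcases Nat.lt_or_ge s (t + 1) with h | h
    · simp only [run]
      rw [Function.update_of_ne (by omega)]
      exact ih (by omega)
    · obtain rfl : s = t + 1 := by omega
      simp [run, pivot]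

end GoldData

theorem mem_received {d : ℕ → ℕ} {t s : ℕ} (hs : s ∈ received d t) : 1 ≤ s ∧ s ≤ t :=
  Finset.mem_Icc.1 (Finset.mem_filter.1 hs).1

theorem mem_pool {d : ℕ → ℕ} {t s : ℕ} (hs : s ∈ pool d t) : 1 ≤ s ∧ s ≤ t := by
  induction t with
  | zero => simp [pool] at hs
  | succ t ih =>
    rw [pool] at hs
    rcases Finset.mem_union.1 (Finset.mem_filter.1 hs).1 with h | h
    · exact ⟨(ih h).1, (ih h).2.trans t.le_succ⟩
    · exact mem_received h

theorem head_mem {d : ℕ → ℕ} {t s : ℕ} (hs : head d t = (s : WithTop ℕ)) : 1 ≤ s ∧ s ≤ t := by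
  have h : s ∈ pool d (t - 1) ∪ received d t := Finset.mem_of_min hs
  rcases Finset.mem_union.1 h with h | h
  · exact ⟨(mem_pool h).1, (mem_pool h).2.trans (t.sub_le 1)⟩
  · exact mem_received h

/-- The pivots satisfy the projected-ascent recursion
`X_{t+1} = Proj_K (X_t + γ_t v̂_t)`, `t ≥ 1`. -/
theorem GoldData.pivot_succ {n : ℕ} (G : GoldData n) (w : ℕ → Euc n) (t : ℕ) (ht : 1 ≤ t) :
    G.pivot w (t + 1) = euclProj G.K (G.pivot w t + G.step t • G.usedEstimate w t) := by
  obtain ⟨t, rfl⟩ : ∃ m, t = m + 1 := ⟨t - 1, by omega⟩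
  have key : (WithTop.recTopCoe 0 (G.run w (t + 1)).2 (head G.delay (t + 1)) : Euc n)
      = G.usedEstimate w (t + 1) := by
    unfold GoldData.usedEstimate
    rcases h : head G.delay (t + 1) with _ | s
    · rfl
    · have hs := head_mem h
      exact G.run_table w (t + 1) s hs.1 hs.2
  rw [← key]
  rfl

/-- The data of a run with step sizes `γ / t ^ c` and sampling radii `δ / t ^ b`, where
`b = min {1/4, 1/3 - α/3}` and `c = max {3/4, 2/3 + α/3}`. -/
def tunedGold {n : ℕ} (γ δ α : ℝ) (K : Set (Euc n)) (p : Euc n) (r : ℝ) (x₁ : Euc n)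
    (u : ℕ → Euc n → ℝ) (d : ℕ → ℕ) : GoldData n where
  K := K
  p := p
  r := r
  init := x₁
  payoff := u
  delay := d
  step := fun t => γ / (t : ℝ) ^ max (3 / 4 : ℝ) (2 / 3 + α / 3)
  radius := fun t => δ / (t : ℝ) ^ min (1 / 4 : ℝ) (1 / 3 - α / 3)

/-! ### Payoffs and regret -/

/-- The standing assumptions on a payoff function `f` on the action set `K`: it is concave and
differentiable, its gradient is bounded by `V` and `β`-Lipschitz, and its values are bounded
by `M`, everything on `K`. -/
structure IsPayoff {n : ℕ} (K : Set (Euc n)) (V β M : ℝ) (f : Euc n → ℝ) : Prop where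
  concave : ConcaveOn ℝ K f
  differentiable : DifferentiableOn ℝ f K
  grad_bound : ∀ x ∈ K, ‖gradientWithin f K x‖ ≤ V
  grad_lipschitz : ∀ x ∈ K, ∀ y ∈ K,
    ‖gradientWithin f K y - gradientWithin f K x‖ ≤ β * ‖y - x‖
  bounded : ∀ x ∈ K, |f x| ≤ M

/-- The expected cumulative payoff difference over rounds `1, …, T` between the fixed action `x`
and the random actions `A t`. -/
def expectedRegret {n : ℕ} {Ω : Type*} [MeasurableSpace Ω] (μ : Measure Ω)
    (u : ℕ → Euc n → ℝ) (A : ℕ → Ω → Euc n) (T : ℕ) (x : Euc n) : ℝ :=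
  ∫ ω, ∑ t ∈ Finset.Icc 1 T, (u t x - u t (A t ω)) ∂μ

/-- The mean (pseudo-)regret: the maximum over `x ∈ K` of the expected payoff difference. -/
def meanRegret {n : ℕ} {Ω : Type*} [MeasurableSpace Ω] (μ : Measure Ω) (K : Set (Euc n))
    (u : ℕ → Euc n → ℝ) (A : ℕ → Ω → Euc n) (T : ℕ) : ℝ :=
  sSup (expectedRegret μ u A T '' K)

end

/-! ### Euclidean projection and payoff functions -/

section Projection

variable {n : ℕ} {K : Set (Euc n)}

/-! The argument is projected gradient ascent with delayed, slightly biased stochastic gradients.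

Bias. Near the pivot `x`, the payoff is affine up to an error quadratic in the sampling radius.
Since a uniform direction on the sphere has mean zero and covariance `1/n` times the identity, the
factor `n / δ_t` makes the affine part average exactly to the gradient, and the quadratic error
leaves a bias of order `δ_t` (`norm_meanEstimate_sub_le`).

Queue. Dequeuing the oldest available round keeps ages under control: a dequeued round `q` is at
most `maxDelay d q` rounds old, and at most `maxDelay d T` rounds are still pending after round `T`
(`le_head_add_maxDelay`, `exists_head_eq`).

Regret. Let round `s` be dequeued at round `t`. By concavity its regret is at most the gradient at
`X_s` paired with `x - X_s`. Replacing the gradient by the mean estimate costs the bias; replacing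
`X_s` by `X_t` costs the drift of the pivot from `s` to `t`. The drift is paired with the mean
estimate, which stays bounded although the estimates grow like `1 / δ_s`. The direction of round `s`
has influenced neither `X_s` nor `X_t`, so in expectation the mean estimate may be traded for the
estimate actually used (`integral_inner_usedEstimate`), and the usual telescoping energy inequality
applies (`sum_inner_usedEstimate_le`).

Rates. The energy term, the variance `γ_t / δ_t ^ 2`, the bias `δ_t`, the drift `γ_t / δ_t` times
the delay, and the pending rounds all sum to order `T ^ c` (`tuned_rates`). No logarithm appears. -/

theorem isNearestPoint_euclProj (hK : IsCompact K) (hc : Convex ℝ K) (hne : K.Nonempty)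
    (y : Euc n) : IsNearestPoint K y (euclProj K y) :=
  (isNearestPoint_iff_eq_euclProj hK hc hne y _).2 rfl

theorem euclProj_mem (hK : IsCompact K) (hc : Convex ℝ K) (hne : K.Nonempty) (y : Euc n) :
    euclProj K y ∈ K :=
  (isNearestPoint_euclProj hK hc hne y).1

theorem euclProj_of_mem (hK : IsCompact K) (hc : Convex ℝ K) {y : Euc n} (hy : y ∈ K) :
    euclProj K y = y :=
  ((isNearestPoint_iff_eq_euclProj hK hc ⟨y, hy⟩ y y).1
    ⟨hy, fun w _ => by simp⟩).symm

theorem inner_sub_euclProj_nonpos (hK : IsCompact K) (hc : Convex ℝ K) (y : Euc n)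
    {w : Euc n} (hw : w ∈ K) : inner ℝ (y - euclProj K y) (w - euclProj K y) ≤ 0 := by
  have hv := isNearestPoint_euclProj hK hc ⟨w, hw⟩ y
  refine (norm_eq_iInf_iff_real_inner_le_zero hc hv.1).1 ?_ w hw
  have : Nonempty K := ⟨⟨w, hw⟩⟩
  refine le_antisymm (le_ciInf fun w => ?_) (ciInf_le ⟨0, ?_⟩ (⟨_, hv.1⟩ : K))
  · rw [norm_sub_rev y, norm_sub_rev y w]
    exact hv.2 w w.2
  · rintro _ ⟨w, rfl⟩
    exact norm_nonneg _

theorem norm_euclProj_sub_euclProj_le (hK : IsCompact K) (hc : Convex ℝ K) (hne : K.Nonempty)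
    (y y' : Euc n) : ‖euclProj K y - euclProj K y'‖ ≤ ‖y - y'‖ := by
  have h1 := inner_sub_euclProj_nonpos hK hc y (euclProj_mem hK hc hne y')
  have h2 := inner_sub_euclProj_nonpos hK hc y' (euclProj_mem hK hc hne y)
  set a := euclProj K y
  set b := euclProj K y'
  have h3 : inner ℝ (a - b) (a - b) ≤ inner ℝ (y - y') (a - b) := by
    have e1 : inner ℝ (y - a) (b - a) = - inner ℝ (y - a) (a - b) := by
      rw [← inner_neg_right, neg_sub]
    have e2 : inner ℝ (y - y') (a - b) = inner ℝ (y - a) (a - b) + inner ℝ (a - b) (a - b)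
        - inner ℝ (y' - b) (a - b) := by
      rw [← inner_add_left, ← inner_sub_left]
      congr 1
      abel
    linarith
  have h4 := real_inner_le_norm (y - y') (a - b)
  rw [real_inner_self_eq_norm_sq] at h3
  by_contra! h
  nlinarith [norm_nonneg (y - y')]

theorem norm_euclProj_sub_le (hK : IsCompact K) (hc : Convex ℝ K) (y : Euc n) {w : Euc n}
    (hw : w ∈ K) : ‖euclProj K y - w‖ ≤ ‖y - w‖ := by
  simpa [euclProj_of_mem hK hc hw] using norm_euclProj_sub_euclProj_le hK hc ⟨w, hw⟩ y w

theorem continuous_euclProj (hK : IsCompact K) (hc : Convex ℝ K) (hne : K.Nonempty) :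
    Continuous (euclProj K) :=
  (LipschitzWith.of_dist_le_mul (K := 1) fun y y' => by
    simpa [dist_eq_norm] using norm_euclProj_sub_euclProj_le hK hc hne y y').continuous

end Projection

/-- Along the segment from `x` to `y` every difference quotient is at least `f y - f x` by
concavity, and the quotients converge to the directional derivative. A one-sided limit suffices, so
`x` may be a boundary point of `K`. -/
theorem ConcaveOn.sub_le_of_hasGradientWithinAt {n : ℕ} {K : Set (Euc n)} {f : Euc n → ℝ}
    (hf : ConcaveOn ℝ K f) {x y g : Euc n} (hx : x ∈ K) (hy : y ∈ K)
    (hg : HasGradientWithinAt f g K x) : f y - f x ≤ inner ℝ g (y - x) := by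
  have hseg : ∀ t ∈ Set.Icc (0 : ℝ) 1, x + t • (y - x) ∈ K := fun t ht => by
    simpa using hf.1.add_smul_sub_mem hx hy ht
  have h1 : HasDerivWithinAt (fun t : ℝ => x + t • (y - x)) (y - x) (Set.Icc 0 1) 0 := by
    simpa using (((hasDerivAt_id (0 : ℝ)).smul_const (y - x)).const_add x).hasDerivWithinAt
  have h0 : x + (0 : ℝ) • (y - x) = x := by simp
  have h2 : HasDerivWithinAt (fun t : ℝ => f (x + t • (y - x))) (inner ℝ g (y - x))
      (Set.Icc 0 1) 0 := by
    have := HasFDerivWithinAt.comp_hasDerivWithinAt (t := K) (0 : ℝ)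
      (by rw [h0]; exact hg.hasFDerivWithinAt) h1 hseg
    exact this
  rw [hasDerivWithinAt_iff_tendsto_slope] at h2
  have hne : (nhdsWithin (0 : ℝ) (Set.Icc 0 1 \ {0})).NeBot := by
    rw [Set.Icc_sdiff_left, nhdsWithin_Ioc_eq_nhdsGT one_pos]
    infer_instance
  refine ge_of_tendsto h2 ?_
  filter_upwards [self_mem_nhdsWithin] with t ht
  have ht0 : 0 < t := lt_of_le_of_ne ht.1.1 (Ne.symm ht.2)
  have hc := hf.2 hx hy (sub_nonneg.2 ht.1.2) ht0.le (by ring)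
  have e : (1 - t) • x + t • y = x + t • (y - x) := by module
  rw [e] at hc
  rw [slope_def_field, h0, sub_zero, le_div_iff₀ ht0]
  simp only [smul_eq_mul] at hc
  nlinarith

namespace IsPayoff

variable {n : ℕ} {K : Set (Euc n)} {V β M : ℝ} {f : Euc n → ℝ}

theorem sub_le_inner (h : IsPayoff K V β M f) {x y : Euc n} (hx : x ∈ K) (hy : y ∈ K) :
    f y - f x ≤ inner ℝ (gradientWithin f K x) (y - x) :=
  h.concave.sub_le_of_hasGradientWithinAt hx hy (h.differentiable x hx).hasGradientWithinAt

theorem abs_sub_le (h : IsPayoff K V β M f) {x y : Euc n} (hx : x ∈ K) (hy : y ∈ K) :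
    |f y - f x| ≤ V * ‖y - x‖ := by
  have key : ∀ x ∈ K, ∀ y ∈ K, f y - f x ≤ V * ‖y - x‖ := fun x hx y hy =>
    (h.sub_le_inner hx hy).trans ((real_inner_le_norm _ _).trans
      (mul_le_mul_of_nonneg_right (h.grad_bound x hx) (norm_nonneg _)))
  refine abs_le.2 ⟨?_, key x hx y hy⟩
  have := key y hy x hx
  rw [norm_sub_rev] at this
  linarith

/-- The first-order concavity inequalities at both endpoints sandwich the increment; the gap between
them is controlled by the Lipschitz bound. This gives `β` in place of the sharp `β / 2` but needs no
integration along the segment. -/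
theorem abs_sub_sub_inner_le (h : IsPayoff K V β M f) {x y : Euc n} (hx : x ∈ K) (hy : y ∈ K) :
    |f y - f x - inner ℝ (gradientWithin f K x) (y - x)| ≤ β * ‖y - x‖ ^ 2 := by
  have h1 := h.sub_le_inner hx hy
  have h2 := h.sub_le_inner hy hx
  have h3 : inner ℝ (gradientWithin f K x - gradientWithin f K y) (y - x)
      ≤ β * ‖y - x‖ ^ 2 := by
    refine (real_inner_le_norm _ _).trans ?_
    have := h.grad_lipschitz x hx y hy
    rw [norm_sub_rev] at this
    nlinarith [norm_nonneg (y - x)]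
  have e : inner ℝ (gradientWithin f K y) (x - y)
      = - inner ℝ (gradientWithin f K y) (y - x) := by
    rw [← inner_neg_right, neg_sub]
  rw [inner_sub_left] at h3
  rw [abs_le]
  constructor <;> linarith

theorem continuousOn (h : IsPayoff K V β M f) : ContinuousOn f K :=
  h.differentiable.continuousOn

theorem congr (h : IsPayoff K V β M f) {g : Euc n → ℝ} (hg : Set.EqOn g f K) :
    IsPayoff K V β M g := by
  have hgrad : ∀ x ∈ K, gradientWithin g K x = gradientWithin f K x := fun x hx => by
    simp only [gradientWithin, fderivWithin_congr hg (hg hx)]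
  refine ⟨h.concave.congr hg.symm, h.differentiable.congr hg, fun x hx => ?_,
    fun x hx y hy => ?_, fun x hx => ?_⟩
  · rw [hgrad x hx]; exact h.grad_bound x hx
  · rw [hgrad x hx, hgrad y hy]; exact h.grad_lipschitz x hx y hy
  · rw [hg hx]; exact h.bounded x hx

end IsPayoff

/-! ### The queue -/

/-- The largest delay among the rounds `1, …, t`. -/
def maxDelay (d : ℕ → ℕ) (t : ℕ) : ℕ := (Finset.Icc 1 t).sup d

theorem le_maxDelay {d : ℕ → ℕ} {s t : ℕ} (h1 : 1 ≤ s) (hs : s ≤ t) : d s ≤ maxDelay d t :=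
  Finset.le_sup (f := d) (Finset.mem_Icc.2 ⟨h1, hs⟩)

theorem maxDelay_mono (d : ℕ → ℕ) : Monotone (maxDelay d) := fun _ _ h =>
  Finset.sup_mono (Finset.Icc_subset_Icc le_rfl h)

/-- The pool is made of the rounds whose reward has been received and that have not been
dequeued yet. -/
theorem mem_pool_iff {d : ℕ → ℕ} {t s : ℕ} :
    s ∈ pool d t ↔ 1 ≤ s ∧ s + d s ≤ t ∧ ∀ k ∈ Finset.Icc 1 t, head d k ≠ s := by
  induction t with
  | zero => simp [pool]; omega
  | succ t ih =>
    rw [pool, Finset.mem_filter, Finset.mem_union, ih]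
    have hh : head d (t + 1) = (pool d t ∪ received d (t + 1)).min := by simp [head]
    rw [← hh]
    simp only [received, Finset.mem_filter, Finset.mem_Icc]
    constructor
    · rintro ⟨h | h, hne⟩
      · refine ⟨h.1, by omega, fun k hk => ?_⟩
        rcases Nat.lt_or_ge k (t + 1) with h' | h'
        · exact h.2.2 k ⟨hk.1, by omega⟩
        · obtain rfl : k = t + 1 := by omega
          exact hne.symm
      · refine ⟨h.1.1, by omega, fun k hk hks => ?_⟩
        rcases Nat.lt_or_ge k (t + 1) with h' | h'
        · have hm : s ∈ pool d (k - 1) ∪ received d k := Finset.mem_of_min hks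
          have hlt : s + d s ≤ k := by
            clear hh hne ih
            rcases Finset.mem_union.1 hm with hm | hm
            · have : ∀ j, s ∈ pool d j → s + d s ≤ j := by
                intro j
                induction j with
                | zero => simp [pool]
                | succ j ihj =>
                  intro hj
                  rw [pool] at hj
                  rcases Finset.mem_union.1 (Finset.mem_filter.1 hj).1 with h | h
                  · exact (ihj h).trans j.le_succ
                  · exact (Finset.mem_filter.1 h).2.le
              exact (this _ hm).trans (by omega)
            · exact (Finset.mem_filter.1 hm).2.le
          omega
        · obtain rfl : k = t + 1 := by omega
          exact hne hks.symm
    · rintro ⟨h1, h2, h3⟩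
      refine ⟨?_, (h3 (t + 1) ⟨by omega, le_rfl⟩).symm⟩
      rcases Nat.lt_or_ge (s + d s) (t + 1) with h' | h'
      · exact Or.inl ⟨h1, by omega, fun k hk => h3 k ⟨hk.1, by omega⟩⟩
      · exact Or.inr ⟨⟨h1, by omega⟩, by omega⟩

/-- The set from which the head of round `t` is chosen. -/
theorem mem_pool_union_received_iff {d : ℕ → ℕ} {t s : ℕ} (ht : 1 ≤ t) :
    s ∈ pool d (t - 1) ∪ received d t ↔
      1 ≤ s ∧ s + d s ≤ t ∧ ∀ k ∈ Finset.Ico 1 t, head d k ≠ s := by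
  rw [Finset.mem_union, mem_pool_iff, received, Finset.mem_filter]
  simp only [Finset.mem_Icc, Finset.mem_Ico]
  constructor
  · rintro (h | h)
    · exact ⟨h.1, by omega, fun k hk => h.2.2 k ⟨hk.1, by omega⟩⟩
    · refine ⟨h.1.1, by omega, fun k hk hks => ?_⟩
      have hm : s ∈ pool d (k - 1) ∪ received d k := Finset.mem_of_min hks
      rw [Finset.mem_union, mem_pool_iff, received, Finset.mem_filter] at hm
      omega
  · rintro ⟨h1, h2, h3⟩
    rcases Nat.lt_or_ge (s + d s) t with h' | h'
    · exact Or.inl ⟨h1, by omega, fun k hk => h3 k ⟨hk.1, by omega⟩⟩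
    · exact Or.inr ⟨⟨h1, by omega⟩, by omega⟩

theorem head_le_of_mem {d : ℕ → ℕ} {t s : ℕ} (ht : 1 ≤ t) (hs : 1 ≤ s) (hd : s + d s ≤ t)
    (hk : ∀ k ∈ Finset.Ico 1 t, head d k ≠ s) : head d t ≤ s :=
  Finset.min_le ((mem_pool_union_received_iff ht).2 ⟨hs, hd, hk⟩)

theorem head_ne_of_lt {d : ℕ → ℕ} {t k s : ℕ} (hk : 1 ≤ k) (hkt : k < t)
    (h : head d t = s) : head d k ≠ s :=
  ((mem_pool_union_received_iff (by omega)).1 (Finset.mem_of_min h)).2.2 k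
    (Finset.mem_Ico.2 ⟨hk, hkt⟩)

/-- A round is dequeued at most once. -/
theorem head_injOn {d : ℕ → ℕ} {t t' s : ℕ} (ht : 1 ≤ t) (ht' : 1 ≤ t')
    (h : head d t = s) (h' : head d t' = s) : t = t' := by
  rcases lt_trichotomy t t' with hlt | rfl | hlt
  · exact absurd h (head_ne_of_lt ht hlt h')
  · rfl
  · exact absurd h' (head_ne_of_lt ht' hlt h)

/-- The dequeued round is at most `maxDelay` rounds old. -/
theorem le_head_add_maxDelay {d : ℕ → ℕ} {t q : ℕ} (ht : 1 ≤ t) (h : head d t = q) :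
    t ≤ q + maxDelay d q := by
  classical
  -- `τ` is the last round at which nothing older than `q` was dequeued
  let τ := Nat.findGreatest (fun j => 1 ≤ j ∧ ¬ head d j ≤ (q : WithTop ℕ)) t
  have hτt : τ ≤ t := Nat.findGreatest_le t
  have hafter : ∀ j, τ < j → j ≤ t → head d j ≤ (q : WithTop ℕ) := fun j hj hjt => by
    by_contra hc
    exact Nat.findGreatest_is_greatest hj hjt ⟨by omega, hc⟩
  have hτ : 1 ≤ τ → ¬ head d τ ≤ (q : WithTop ℕ) := fun h1 => by
    have := Nat.findGreatest_of_ne_zero (m := τ) (n := t)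
      (P := fun j => 1 ≤ j ∧ ¬ head d j ≤ (q : WithTop ℕ)) rfl (by omega)
    exact this.2
  have hex : ∀ j ∈ Finset.Ioc τ t, ∃ s : ℕ, head d j = s ∧ s ≤ q := fun j hj => by
    rw [Finset.mem_Ioc] at hj
    have h1 := hafter j hj.1 hj.2
    obtain ⟨s, hs⟩ := WithTop.ne_top_iff_exists.1 (ne_top_of_le_ne_top (WithTop.coe_ne_top) h1)
    rw [← hs] at h1
    exact ⟨s, hs.symm, WithTop.coe_le_coe.1 h1⟩
  choose! f hf hfq using hex
  -- Rounds after `τ` dequeue distinct elements not exceeding `q`. None of them is as old as `τ -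
  -- maxDelay d q`: its reward would have arrived by round `τ`, and the head at `τ` would then be at
  -- most `q`.
  have hcard : (Finset.Ioc τ t).card ≤ (Finset.Ioc (τ - maxDelay d q) q).card := by
    refine Finset.card_le_card_of_injOn f (fun j hj => ?_) fun j hj j' hj' hjj => ?_
    · have hj : j ∈ Finset.Ioc τ t := hj
      have h1 := hf j hj
      have h2 := hfq j hj
      have hj' := Finset.mem_Ioc.1 hj
      have hpos := (head_mem h1).1
      simp only [Finset.coe_Ioc, Set.mem_Ioc]
      refine ⟨?_, h2⟩
      by_contra! hle
      have hτ1 : 1 ≤ τ := by omega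
      refine hτ hτ1 ((head_le_of_mem hτ1 hpos ?_ fun k hk => ?_).trans (by exact_mod_cast h2))
      · have := le_maxDelay (d := d) hpos h2
        omega
      · rw [Finset.mem_Ico] at hk
        exact head_ne_of_lt hk.1 (by omega) h1
    · have h1 := hf j hj
      have h2 := hf j' hj'
      have hj := Finset.mem_Ioc.1 hj
      have hj' := Finset.mem_Ioc.1 hj'
      rw [← hjj] at h2
      exact head_injOn (by omega) (by omega) h1 h2
  -- Makes the left count positive, which excludes the case where the truncated subtraction on the
  -- right gives zero.
  have hlt : τ ≠ t := fun he => hτ (by omega) (by rw [he, h])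
  simp only [Nat.card_Ioc] at hcard
  omega

/-- A round is dequeued within `maxDelay` rounds. -/
theorem exists_head_eq {d : ℕ → ℕ} {s T : ℕ} (hs : 1 ≤ s) (hT : s + maxDelay d s < T + 1) :
    ∃ t ∈ Finset.Icc 1 T, head d t = s := by
  by_contra! hno
  -- at round `s + maxDelay d s` the head is at most `s`
  have key : ∀ t, 1 ≤ t → s + d s ≤ t → (∀ k ∈ Finset.Icc 1 t, head d k ≠ s) →
      ∃ q : ℕ, head d t = q ∧ q < s := fun t ht hst hk => by
    have h1 := head_le_of_mem ht hs hst fun k hkt => hk k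
      (Finset.mem_Icc.2 ⟨(Finset.mem_Ico.1 hkt).1, (Finset.mem_Ico.1 hkt).2.le⟩)
    obtain ⟨q, hq⟩ := WithTop.ne_top_iff_exists.1 (ne_top_of_le_ne_top (WithTop.coe_ne_top) h1)
    refine ⟨q, hq.symm, lt_of_le_of_ne ?_ ?_⟩
    · rw [← hq] at h1
      exact WithTop.coe_le_coe.1 h1
    · rintro rfl
      exact hk t (Finset.mem_Icc.2 ⟨ht, le_rfl⟩) hq.symm
  have hds := le_maxDelay (d := d) hs le_rfl
  obtain ⟨q, hq, hqs⟩ := key (s + maxDelay d s) (by omega) (by omega) fun k hk =>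
    hno k (Finset.Icc_subset_Icc le_rfl (by omega) hk)
  -- A head `q < s` at round `s + maxDelay d s` would be older than `maxDelay d q` allows, by
  -- monotonicity of `maxDelay`.
  have h1 := le_head_add_maxDelay (by omega) hq
  have h2 := maxDelay_mono d hqs.le
  omega

/-- The finitely many rounds before the asymptotic bound takes effect go into the constant. The
exponent is truncated at `0` because a running maximum does not decay even when `α < 0`. -/
theorem exists_maxDelay_le {d : ℕ → ℕ} {α : ℝ}
    (hd : (fun t : ℕ => (d t : ℝ)) =o[atTop] (fun t : ℕ => (t : ℝ) ^ α)) :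
    ∃ A : ℝ, 0 ≤ A ∧ ∀ t : ℕ, 1 ≤ t → (maxDelay d t : ℝ) ≤ A * (t : ℝ) ^ max α 0 := by
  obtain ⟨N, hN⟩ := eventually_atTop.1 (hd.bound one_pos)
  refine ⟨1 + ∑ s ∈ Finset.range N, (d s : ℝ), by positivity, fun t ht => ?_⟩
  have ht' : (1 : ℝ) ≤ t := by exact_mod_cast ht
  have hpow : (1 : ℝ) ≤ (t : ℝ) ^ max α 0 := Real.one_le_rpow ht' (le_max_right _ _)
  have hsum : (0 : ℝ) ≤ ∑ s ∈ Finset.range N, (d s : ℝ) := by positivity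
  obtain ⟨s, hs, hst⟩ := Finset.exists_mem_eq_sup (Finset.Icc 1 t) ⟨1, by simp [ht]⟩ d
  rw [maxDelay, hst]
  rw [Finset.mem_Icc] at hs
  rcases Nat.lt_or_ge s N with h | h
  · have : (d s : ℝ) ≤ ∑ s ∈ Finset.range N, (d s : ℝ) :=
      Finset.single_le_sum (f := fun s => (d s : ℝ)) (fun _ _ => Nat.cast_nonneg _)
        (Finset.mem_range.2 h)
    nlinarith
  · have h1 := hN s h
    have hs1 : (1 : ℝ) ≤ s := by exact_mod_cast hs.1
    rw [one_mul, Real.norm_of_nonneg (by positivity), Real.norm_of_nonneg (by positivity)] at h1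
    have h2 : (s : ℝ) ^ α ≤ (t : ℝ) ^ max α 0 :=
      (Real.rpow_le_rpow_of_exponent_le hs1 (le_max_left _ _)).trans
        (Real.rpow_le_rpow (by positivity) (by exact_mod_cast hs.2) (le_max_right _ _))
    nlinarith

/-! ### Moments of the uniform distribution on the sphere -/

section Sphere

variable {n : ℕ}

/-- The action of a linear isometry on the unit sphere. -/
noncomputable def sphereMap (e : Euc n ≃ₗᵢ[ℝ] Euc n) (y : UnitSphere n) : UnitSphere n :=
  ⟨e y, by simp⟩

theorem continuous_sphereMap (e : Euc n ≃ₗᵢ[ℝ] Euc n) : Continuous (sphereMap e) :=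
  (e.continuous.comp continuous_subtype_val).subtype_mk _

/-- Surface measure of a set is a multiple of the volume of the cone over it, and a linear isometry
maps cones to cones and preserves volume. -/
theorem measurePreserving_sphereMap (e : Euc n ≃ₗᵢ[ℝ] Euc n) :
    MeasurePreserving (sphereMap e) (uniformSphere n) (uniformSphere n) := by
  have hm : Measurable (sphereMap e) := (continuous_sphereMap e).measurable
  refine MeasurePreserving.smul_measure ⟨hm, Measure.ext fun s hs => ?_⟩ _
  rw [Measure.map_apply hm hs, Measure.toSphere_apply' _ (hm hs), Measure.toSphere_apply' _ hs]
  congr 1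
  rw [← e.symm.measurePreserving.measure_preimage_emb e.symm.toHomeomorph.measurableEmbedding]
  congr 1
  ext x
  simp only [Set.mem_smul, Set.mem_preimage, Set.mem_image]
  constructor
  · rintro ⟨a, ha, _, ⟨y, hy, rfl⟩, h⟩
    refine ⟨a, ha, _, ⟨_, hy, rfl⟩, ?_⟩
    rw [← e.apply_symm_apply x, ← h]
    simp [sphereMap]
  · rintro ⟨a, ha, _, ⟨y, hy, rfl⟩, h⟩
    refine ⟨a, ha, _, ⟨sphereMap e.symm y, ?_, rfl⟩, ?_⟩
    · simpa [sphereMap] using hy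
    · apply e.injective
      simpa [sphereMap] using h

theorem integral_sphereMap (e : Euc n ≃ₗᵢ[ℝ] Euc n) (f : UnitSphere n → ℝ) :
    ∫ y, f (sphereMap e y) ∂(uniformSphere n) = ∫ y, f y ∂(uniformSphere n) := by
  have hinv : Function.LeftInverse (sphereMap e.symm) (sphereMap e) := fun y => by
    simp [sphereMap]
  have hinv' : Function.RightInverse (sphereMap e.symm) (sphereMap e) := fun y => by
    simp [sphereMap]
  let E : UnitSphere n ≃ₜ UnitSphere n :=
    ⟨⟨sphereMap e, sphereMap e.symm, hinv, hinv'⟩, continuous_sphereMap e,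
      continuous_sphereMap e.symm⟩
  exact (measurePreserving_sphereMap e).integral_comp E.measurableEmbedding f

theorem norm_unitSphere (y : UnitSphere n) : ‖(y : Euc n)‖ = 1 := by simp

/-- Antipodal symmetry. -/
theorem integral_inner_uniformSphere (a : Euc n) :
    ∫ y : UnitSphere n, inner ℝ a (y : Euc n) ∂(uniformSphere n) = 0 := by
  have h := integral_sphereMap (LinearIsometryEquiv.neg ℝ) fun y : UnitSphere n =>
    inner ℝ a (y : Euc n)
  simp only [sphereMap, LinearIsometryEquiv.coe_neg, inner_neg_right] at h
  rw [integral_neg] at h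
  linarith

theorem integrable_of_continuous_unitSphere [IsFiniteMeasure (uniformSphere n)]
    {f : UnitSphere n → ℝ} (hf : Continuous f) : Integrable f (uniformSphere n) :=
  (BoundedContinuousFunction.mkOfCompact ⟨f, hf⟩).integrable _

/-- A reflection exchanges any two vectors of equal norm, so the second moment depends only on
`‖a‖`. It is the same for all coordinate vectors, for which the sum is `1`, and it scales
quadratically. -/
theorem integral_inner_sq_uniformSphere [IsProbabilityMeasure (uniformSphere n)] (hn : 1 ≤ n)
    (a : Euc n) :
    ∫ y : UnitSphere n, (inner ℝ a (y : Euc n)) ^ 2 ∂(uniformSphere n) = ‖a‖ ^ 2 / n := by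
  let Q : Euc n → ℝ := fun a => ∫ y : UnitSphere n, (inner ℝ a (y : Euc n)) ^ 2 ∂(uniformSphere n)
  have hQ : ∀ a b : Euc n, ‖a‖ = ‖b‖ → Q a = Q b := fun a b hab => by
    have h := integral_sphereMap (Submodule.reflection (Submodule.span ℝ {a - b})ᗮ)
      fun y : UnitSphere n => (inner ℝ b (y : Euc n)) ^ 2
    refine Eq.trans ?_ h
    refine integral_congr_ae (.of_forall fun y => ?_)
    have hR := LinearIsometryEquiv.inner_map_map
      (Submodule.reflection (Submodule.span ℝ {a - b})ᗮ) a (y : Euc n)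
    rw [Submodule.reflection_sub hab] at hR
    simp only [sphereMap, hR]
  let e : Fin n → Euc n := fun i => EuclideanSpace.single i 1
  have hsum : ∑ i, Q (e i) = 1 := by
    rw [← integral_finsetSum _ fun i _ => integrable_of_continuous_unitSphere (by fun_prop)]
    have : ∀ y : UnitSphere n, ∑ i, (inner ℝ (e i) (y : Euc n)) ^ 2 = 1 := fun y => by
      have h := EuclideanSpace.real_norm_sq_eq (y : Euc n)
      rw [norm_unitSphere] at h
      simpa [e, EuclideanSpace.inner_single_left] using h.symm
    simp [this]
  have i0 : Fin n := ⟨0, hn⟩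
  have hunit : Q (e i0) = 1 / n := by
    have : ∀ i, Q (e i) = Q (e i0) := fun i => hQ _ _ (by simp [e])
    simp only [this, Finset.sum_const, Finset.card_univ, Fintype.card_fin, nsmul_eq_mul] at hsum
    have : (n : ℝ) ≠ 0 := by positivity
    field_simp
    linarith
  have hscale : Q (‖a‖ • e i0) = ‖a‖ ^ 2 * Q (e i0) := by
    simp only [Q, inner_smul_left, mul_pow, ← integral_const_mul]
    simp
  change Q a = _
  rw [hQ a (‖a‖ • e i0) (by simp [norm_smul, e]), hscale, hunit]
  ring

theorem integral_inner_mul_inner_uniformSphere [IsProbabilityMeasure (uniformSphere n)]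
    (hn : 1 ≤ n) (a b : Euc n) :
    ∫ y : UnitSphere n, inner ℝ a (y : Euc n) * inner ℝ b (y : Euc n) ∂(uniformSphere n)
      = inner ℝ a b / n := by
  have h : ∀ y : UnitSphere n, inner ℝ a (y : Euc n) * inner ℝ b (y : Euc n)
      = ((inner ℝ (a + b) (y : Euc n)) ^ 2 - (inner ℝ a (y : Euc n)) ^ 2
        - (inner ℝ b (y : Euc n)) ^ 2) / 2 := fun y => by
    rw [inner_add_left]
    ring
  simp only [h]
  rw [integral_div, integral_sub, integral_sub, integral_inner_sq_uniformSphere hn,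
    integral_inner_sq_uniformSphere hn, integral_inner_sq_uniformSphere hn, norm_add_sq_real]
  · ring
  all_goals exact integrable_of_continuous_unitSphere (by fun_prop)

end Sphere

/-! ### Pathwise properties of the policy -/

namespace GoldData

variable {n : ℕ}

/-- The assumptions on the data of a run: those of the setting, with payoff functions that are
moreover measurable and bounded outside the action set. -/
structure IsRegular (G : GoldData n) (D V β M : ℝ) : Prop where
  r_pos : 0 < G.r
  isCompact : IsCompact G.K
  convex : Convex ℝ G.K
  diam_le : diam G.K ≤ D
  ball_subset : closedBall G.p G.r ⊆ G.K
  init_mem : G.init ∈ G.K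
  payoff : ∀ t, 1 ≤ t → IsPayoff G.K V β M (G.payoff t)
  measurable_payoff : ∀ t, 1 ≤ t → Measurable (G.payoff t)
  abs_payoff_le : ∀ t, 1 ≤ t → ∀ x, |G.payoff t x| ≤ M
  radius_pos : ∀ t, 1 ≤ t → 0 < G.radius t
  radius_le : ∀ t, 1 ≤ t → G.radius t ≤ G.r
  radius_anti : ∀ s t, 1 ≤ s → s ≤ t → G.radius t ≤ G.radius s
  step_pos : ∀ t, 1 ≤ t → 0 < G.step t
  step_anti : ∀ t, 1 ≤ t → G.step (t + 1) ≤ G.step t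

theorem usedEstimate_of_head_eq (G : GoldData n) (w : ℕ → Euc n) {t s : ℕ}
    (h : head G.delay t = s) : G.usedEstimate w t = G.estimate s (G.pivot w s) (w s) := by
  rw [usedEstimate, h]
  rfl

theorem usedEstimate_of_head_eq_top (G : GoldData n) (w : ℕ → Euc n) {t : ℕ}
    (h : head G.delay t = ⊤) : G.usedEstimate w t = 0 := by
  rw [usedEstimate, h]
  rfl

/-- The pivot depends only on the directions of the rounds dequeued before. -/
theorem pivot_congr (G : GoldData n) {w w' : ℕ → Euc n} {t : ℕ}
    (h : ∀ j, 1 ≤ j → j < t → ∀ q : ℕ, head G.delay j = q → w q = w' q) :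
    ∀ m ≤ t, G.pivot w m = G.pivot w' m := by
  intro m
  induction m using Nat.strong_induction_on with
  | _ m ih =>
    intro hm
    rcases Nat.lt_or_ge m 2 with h2 | h2
    · interval_cases m <;> rfl
    · obtain ⟨m, rfl⟩ : ∃ j, m = j + 1 := ⟨m - 1, by omega⟩
      rw [G.pivot_succ w m (by omega), G.pivot_succ w' m (by omega), ih m (by omega) (by omega)]
      rcases hq : head G.delay m with _ | q
      · rw [G.usedEstimate_of_head_eq_top w hq, G.usedEstimate_of_head_eq_top w' hq]
      · have hqm := head_mem hq
        rw [G.usedEstimate_of_head_eq w hq, G.usedEstimate_of_head_eq w' hq,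
          h m (by omega) (by omega) q hq, ih q (by omega) (by omega)]

/-- The action is the convex combination of `x` and the point `p + r • w` of the safety ball, with
weight `ρ / r` on the latter. -/
theorem action_mem_of_mem {K : Set (Euc n)} (hc : Convex ℝ K) {p x w : Euc n} {r ρ : ℝ}
    (hr : 0 < r) (hb : closedBall p r ⊆ K) (hx : x ∈ K) (h0 : 0 ≤ ρ) (hρ : ρ ≤ r)
    (hw : ‖w‖ = 1) : x + ρ • (w - r⁻¹ • (x - p)) ∈ K := by
  have h1 : p + r • w ∈ K := hb (by simp [norm_smul, hw, abs_of_pos hr])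
  have h2 := hc.add_smul_sub_mem hx h1 (t := ρ / r) ⟨by positivity, (div_le_one hr).2 hρ⟩
  convert h2 using 2
  have e : p + r • w - x = r • (w - r⁻¹ • (x - p)) := by
    rw [smul_sub, smul_smul, mul_inv_cancel₀ hr.ne']
    module
  rw [e, smul_smul, div_mul_cancel₀ _ hr.ne']

/-- The pivots do not depend on the values of the payoffs outside the action set. -/
theorem pivot_congr_payoff (G : GoldData n) (v : ℕ → Euc n → ℝ) (hK : IsCompact G.K)
    (hc : Convex ℝ G.K) (hr : 0 < G.r) (hb : closedBall G.p G.r ⊆ G.K) (hi : G.init ∈ G.K)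
    (hρ : ∀ t, 1 ≤ t → 0 ≤ G.radius t ∧ G.radius t ≤ G.r)
    (hv : ∀ t, 1 ≤ t → Set.EqOn (v t) (G.payoff t) G.K)
    {w : ℕ → Euc n} (hw : ∀ t, ‖w t‖ = 1) (t : ℕ) :
    ({ G with payoff := v } : GoldData n).pivot w t = G.pivot w t := by
  have hmem : ∀ t, G.pivot w t ∈ G.K := fun t => by
    rcases Nat.lt_or_ge t 2 with h2 | h2
    · interval_cases t <;> exact hi
    · obtain ⟨t, rfl⟩ : ∃ j, t = j + 1 := ⟨t - 1, by omega⟩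
      rw [G.pivot_succ w t (by omega)]
      exact euclProj_mem hK hc ⟨_, hi⟩ _
  induction t using Nat.strong_induction_on with
  | _ t ih =>
    rcases Nat.lt_or_ge t 2 with h2 | h2
    · interval_cases t <;> rfl
    · obtain ⟨t, rfl⟩ : ∃ j, t = j + 1 := ⟨t - 1, by omega⟩
      rw [G.pivot_succ w t (by omega), pivot_succ _ w t (by omega), ih t (by omega)]
      rcases hq : head G.delay t with _ | q
      · rw [G.usedEstimate_of_head_eq_top w hq, usedEstimate_of_head_eq_top _ w (by exact hq)]
      · have hqm := head_mem hq
        rw [G.usedEstimate_of_head_eq w hq, usedEstimate_of_head_eq _ w (s := q) (by exact hq),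
          ih q (by omega)]
        have := hv q hqm.1 (action_mem_of_mem hc hr hb (hmem q) (hρ q hqm.1).1 (hρ q hqm.1).2
          (hw q))
        simp only [estimate, action]
        rw [this]

namespace IsRegular

variable {G : GoldData n} {D V β M : ℝ}

theorem D_nonneg (h : G.IsRegular D V β M) : 0 ≤ D := diam_nonneg.trans h.diam_le

theorem norm_sub_le (h : G.IsRegular D V β M) {x y : Euc n} (hx : x ∈ G.K) (hy : y ∈ G.K) :
    ‖x - y‖ ≤ D := by
  rw [← dist_eq_norm]
  exact (dist_le_diam_of_mem h.isCompact.isBounded hx hy).trans h.diam_le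

theorem p_mem (h : G.IsRegular D V β M) : G.p ∈ G.K :=
  h.ball_subset (mem_closedBall_self h.r_pos.le)

theorem M_nonneg (h : G.IsRegular D V β M) : 0 ≤ M :=
  (abs_nonneg _).trans (h.abs_payoff_le 1 le_rfl 0)

theorem V_nonneg (h : G.IsRegular D V β M) : 0 ≤ V :=
  (norm_nonneg _).trans ((h.payoff 1 le_rfl).grad_bound _ h.init_mem)

theorem pivot_mem (h : G.IsRegular D V β M) (w : ℕ → Euc n) (t : ℕ) : G.pivot w t ∈ G.K := by
  rcases Nat.lt_or_ge t 2 with h2 | h2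
  · interval_cases t <;> exact h.init_mem
  · obtain ⟨t, rfl⟩ : ∃ j, t = j + 1 := ⟨t - 1, by omega⟩
    rw [G.pivot_succ w t (by omega)]
    exact euclProj_mem h.isCompact h.convex ⟨_, h.init_mem⟩ _

theorem action_mem (h : G.IsRegular D V β M) {t : ℕ} (ht : 1 ≤ t) {x w : Euc n} (hx : x ∈ G.K)
    (hw : ‖w‖ = 1) : G.action t x w ∈ G.K :=
  action_mem_of_mem h.convex h.r_pos h.ball_subset hx (h.radius_pos t ht).le (h.radius_le t ht) hw

theorem norm_action_sub_le (h : G.IsRegular D V β M) {t : ℕ} (ht : 1 ≤ t) {x w : Euc n}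
    (hx : x ∈ G.K) (hw : ‖w‖ = 1) :
    ‖G.action t x w - x‖ ≤ G.radius t * (1 + D / G.r) := by
  rw [action, add_sub_cancel_left, norm_smul, Real.norm_of_nonneg (h.radius_pos t ht).le]
  refine mul_le_mul_of_nonneg_left ((_root_.norm_sub_le _ _).trans ?_) (h.radius_pos t ht).le
  rw [hw, norm_smul, norm_inv, Real.norm_of_nonneg h.r_pos.le, div_eq_inv_mul]
  have := mul_le_mul_of_nonneg_left (h.norm_sub_le hx h.p_mem) (inv_nonneg.2 h.r_pos.le)
  linarith

theorem norm_estimate_le (h : G.IsRegular D V β M) {t : ℕ} (ht : 1 ≤ t) (x : Euc n) {w : Euc n}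
    (hw : ‖w‖ = 1) : ‖G.estimate t x w‖ ≤ n / G.radius t * M := by
  have h0 := h.radius_pos t ht
  rw [estimate, norm_smul, hw, mul_one, norm_mul, Real.norm_of_nonneg (by positivity)]
  exact mul_le_mul_of_nonneg_left (h.abs_payoff_le t ht _) (by positivity)

/-- The dequeued round is no later than `t` and radii decrease, so the current radius gives the
worst bound. -/
theorem norm_usedEstimate_le (h : G.IsRegular D V β M) {w : ℕ → Euc n} (hw : ∀ t, ‖w t‖ = 1)
    {t : ℕ} (ht : 1 ≤ t) : ‖G.usedEstimate w t‖ ≤ n / G.radius t * M := by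
  have h0 := h.radius_pos t ht
  have hM := h.M_nonneg
  rcases hq : head G.delay t with _ | q
  · rw [G.usedEstimate_of_head_eq_top w hq, norm_zero]
    positivity
  · have hqm := head_mem hq
    rw [G.usedEstimate_of_head_eq w hq]
    refine (h.norm_estimate_le hqm.1 _ (hw q)).trans ?_
    have := h.radius_anti q t hqm.1 hqm.2
    gcongr

theorem measurable_action (t : ℕ) :
    Measurable (fun z : Euc n × Euc n => G.action t z.1 z.2) := by
  unfold action
  fun_prop

theorem measurable_estimate (h : G.IsRegular D V β M) {t : ℕ} (ht : 1 ≤ t) :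
    Measurable (fun z : Euc n × Euc n => G.estimate t z.1 z.2) := by
  unfold estimate
  exact (((h.measurable_payoff t ht).comp (measurable_action t)).const_mul _).smul measurable_snd

theorem measurable_pivot (h : G.IsRegular D V β M) (t : ℕ) :
    Measurable (fun w : ℕ → Euc n => G.pivot w t) := by
  induction t using Nat.strong_induction_on with
  | _ t ih =>
    rcases Nat.lt_or_ge t 2 with h2 | h2
    · interval_cases t <;> exact measurable_const
    · obtain ⟨t, rfl⟩ : ∃ j, t = j + 1 := ⟨t - 1, by omega⟩
      simp only [G.pivot_succ _ t (show 1 ≤ t by omega)]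
      suffices hU : Measurable (fun w : ℕ → Euc n => G.usedEstimate w t) from
        (continuous_euclProj h.isCompact h.convex ⟨_, h.init_mem⟩).measurable.comp
          ((ih t (by omega)).add (hU.const_smul (G.step t)))
      rcases hq : head G.delay t with _ | q
      · simp only [G.usedEstimate_of_head_eq_top _ hq]
        exact measurable_const
      · have hqm := head_mem hq
        have hq' : ∀ w : ℕ → Euc n,
            G.usedEstimate w t = G.estimate q (G.pivot w q) (w q) := fun w =>
          G.usedEstimate_of_head_eq w hq
        have hpair : Measurable (fun w : ℕ → Euc n => (G.pivot w q, w q)) :=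
          (ih q (by omega)).prodMk (measurable_pi_apply q)
        rw [funext hq']
        have hest := h.measurable_estimate hqm.1
        have hcomp := hest.comp hpair
        exact hcomp

/-! ### Drift of the pivots and the energy inequality -/

theorem norm_pivot_succ_sub_le (h : G.IsRegular D V β M) (w : ℕ → Euc n) {t : ℕ} (ht : 1 ≤ t) :
    ‖G.pivot w (t + 1) - G.pivot w t‖ ≤ G.step t * ‖G.usedEstimate w t‖ := by
  rw [G.pivot_succ w t ht]
  refine (norm_euclProj_sub_le h.isCompact h.convex _ (h.pivot_mem w t)).trans ?_
  rw [add_sub_cancel_left, norm_smul, Real.norm_of_nonneg (h.step_pos t ht).le]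

theorem norm_pivot_sub_le (h : G.IsRegular D V β M) (w : ℕ → Euc n) {s t : ℕ} (hs : 1 ≤ s)
    (hst : s ≤ t) : ‖G.pivot w t - G.pivot w s‖
      ≤ ∑ k ∈ Finset.Ico s t, G.step k * ‖G.usedEstimate w k‖ := by
  induction t, hst using Nat.le_induction with
  | base => simp
  | succ t hst ih =>
    rw [Finset.sum_Ico_succ_top hst]
    have h1 := h.norm_pivot_succ_sub_le w (hs.trans hst)
    have h2 := norm_add_le (G.pivot w (t + 1) - G.pivot w t) (G.pivot w t - G.pivot w s)
    rw [sub_add_sub_cancel] at h2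
    linarith

/-- Projection does not increase the distance to `x`; expand the square of the distance before
projecting. -/
theorem inner_usedEstimate_le (h : G.IsRegular D V β M) (w : ℕ → Euc n) {t : ℕ} (ht : 1 ≤ t)
    {x : Euc n} (hx : x ∈ G.K) : inner ℝ (G.usedEstimate w t) (x - G.pivot w t)
      ≤ (‖G.pivot w t - x‖ ^ 2 - ‖G.pivot w (t + 1) - x‖ ^ 2) / (2 * G.step t)
        + G.step t * ‖G.usedEstimate w t‖ ^ 2 / 2 := by
  have h0 := h.step_pos t ht
  have h1 := norm_euclProj_sub_le h.isCompact h.convex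
    (G.pivot w t + G.step t • G.usedEstimate w t) hx
  rw [← G.pivot_succ w t ht, add_sub_right_comm] at h1
  have h2 := pow_le_pow_left₀ (norm_nonneg _) h1 2
  rw [norm_add_sq_real, norm_smul, Real.norm_of_nonneg h0.le, inner_smul_right,
    real_inner_comm] at h2
  have e : inner ℝ (G.usedEstimate w t) (x - G.pivot w t)
      = - inner ℝ (G.usedEstimate w t) (G.pivot w t - x) := by
    rw [← inner_neg_right, neg_sub]
  rw [e, ← sub_le_iff_le_add, le_div_iff₀ (by positivity)]
  nlinarith

theorem sum_inner_usedEstimate_le (h : G.IsRegular D V β M) (w : ℕ → Euc n) {T : ℕ} (hT : 1 ≤ T)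
    {x : Euc n} (hx : x ∈ G.K) :
    ∑ t ∈ Finset.Icc 1 T, inner ℝ (G.usedEstimate w t) (x - G.pivot w t)
      ≤ D ^ 2 / (2 * G.step T)
        + ∑ t ∈ Finset.Icc 1 T, G.step t * ‖G.usedEstimate w t‖ ^ 2 / 2 := by
  have hD : ∀ t, ‖G.pivot w t - x‖ ^ 2 ≤ D ^ 2 := fun t =>
    pow_le_pow_left₀ (norm_nonneg _) (h.norm_sub_le (h.pivot_mem w t) hx) 2
  -- The last squared distance is kept for the induction: `D ^ 2` minus it is nonnegative, so
  -- passing to a smaller step in the denominator only increases the bound and the sum telescopes.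
  suffices ∑ t ∈ Finset.Icc 1 T, inner ℝ (G.usedEstimate w t) (x - G.pivot w t)
      ≤ (D ^ 2 - ‖G.pivot w (T + 1) - x‖ ^ 2) / (2 * G.step T)
        + ∑ t ∈ Finset.Icc 1 T, G.step t * ‖G.usedEstimate w t‖ ^ 2 / 2 by
    refine this.trans (add_le_add_left ?_ _)
    have := h.step_pos T hT
    gcongr
    linarith [sq_nonneg ‖G.pivot w (T + 1) - x‖]
  induction T, hT using Nat.le_induction with
  | base =>
    have h1 := h.inner_usedEstimate_le w le_rfl hx
    have h0 := h.step_pos 1 le_rfl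
    simp only [Finset.Icc_self, Finset.sum_singleton]
    refine h1.trans (add_le_add_left ?_ _)
    have := hD 1
    gcongr
  | succ T hT ih =>
    rw [Finset.sum_Icc_succ_top (by omega), Finset.sum_Icc_succ_top (by omega)]
    have h1 := h.inner_usedEstimate_le w (show 1 ≤ T + 1 by omega) hx
    have h0 := h.step_pos T hT
    have h0' := h.step_pos (T + 1) (by omega)
    have h2 : (D ^ 2 - ‖G.pivot w (T + 1) - x‖ ^ 2) / (2 * G.step T)
        ≤ (D ^ 2 - ‖G.pivot w (T + 1) - x‖ ^ 2) / (2 * G.step (T + 1)) := by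
      have := hD (T + 1)
      have := h.step_anti T hT
      gcongr
    have h3 : (D ^ 2 - ‖G.pivot w (T + 1) - x‖ ^ 2) / (2 * G.step (T + 1))
        + (‖G.pivot w (T + 1) - x‖ ^ 2 - ‖G.pivot w (T + 1 + 1) - x‖ ^ 2)
          / (2 * G.step (T + 1))
        = (D ^ 2 - ‖G.pivot w (T + 1 + 1) - x‖ ^ 2) / (2 * G.step (T + 1)) := by
      ring
    linarith

end IsRegular

end GoldData

/-! ### The gradient estimates in the mean -/

namespace GoldData

variable {n : ℕ}

/-- The mean of the gradient estimate of round `t` from pivot `x`. -/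
noncomputable def meanEstimate (G : GoldData n) (t : ℕ) (x : Euc n) : Euc n :=
  ∫ y : UnitSphere n, G.estimate t x y ∂(uniformSphere n)

namespace IsRegular

variable {G : GoldData n} {D V β M : ℝ}

theorem integrable_estimate [IsProbabilityMeasure (uniformSphere n)] (h : G.IsRegular D V β M)
    {t : ℕ} (ht : 1 ≤ t) (x : Euc n) :
    Integrable (fun y : UnitSphere n => G.estimate t x y) (uniformSphere n) :=
  Integrable.of_bound ((h.measurable_estimate ht).comp
    (measurable_const.prodMk measurable_subtype_coe)).aestronglyMeasurable _
    (.of_forall fun y => h.norm_estimate_le ht x (norm_unitSphere y))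

theorem measurable_meanEstimate [IsProbabilityMeasure (uniformSphere n)]
    (h : G.IsRegular D V β M) {t : ℕ} (ht : 1 ≤ t) : Measurable (G.meanEstimate t) := by
  have : StronglyMeasurable (fun z : Euc n × UnitSphere n => G.estimate t z.1 z.2) :=
    ((h.measurable_estimate ht).comp
      (measurable_fst.prodMk (measurable_subtype_coe.comp measurable_snd))).stronglyMeasurable
  exact this.integral_prod_right.measurable

theorem inner_meanEstimate [IsProbabilityMeasure (uniformSphere n)] (h : G.IsRegular D V β M)
    {t : ℕ} (ht : 1 ≤ t) (x a : Euc n) : inner ℝ (G.meanEstimate t x) a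
      = ∫ y : UnitSphere n, inner ℝ (G.estimate t x y) a ∂(uniformSphere n) := by
  rw [real_inner_comm, meanEstimate, ← integral_inner (h.integrable_estimate ht x)]
  simp only [real_inner_comm]

/-- The bias of the gradient estimate. -/
theorem norm_meanEstimate_sub_le [IsProbabilityMeasure (uniformSphere n)] (hn : 1 ≤ n)
    (h : G.IsRegular D V β M) {t : ℕ} (ht : 1 ≤ t) {x : Euc n} (hx : x ∈ G.K) :
    ‖G.meanEstimate t x - gradientWithin (G.payoff t) G.K x‖
      ≤ n * |β| * (1 + D / G.r) ^ 2 * G.radius t := by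
  set g := gradientWithin (G.payoff t) G.K x
  set a := G.meanEstimate t x - g with ha
  set B := n * |β| * (1 + D / G.r) ^ 2 * G.radius t
  have hρ := h.radius_pos t ht
  have hn0 : (n : ℝ) ≠ 0 := by positivity
  have hB : 0 ≤ B := by positivity
  -- The estimate with the payoff replaced by its affine approximation at `x`, tested against the
  -- error `a` itself. Its mean is exactly `inner ℝ g a`, so the remainder yields `‖a‖ ^ 2 ≤ B *
  -- ‖a‖`.
  let f₀ : UnitSphere n → ℝ := fun y =>
    n / G.radius t * (G.payoff t x + inner ℝ g (G.action t x y - x)) * inner ℝ a (y : Euc n)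
  have hf₀ : f₀ = fun y : UnitSphere n =>
      n / G.radius t * (G.payoff t x - G.radius t * inner ℝ g (G.r⁻¹ • (x - G.p)))
          * inner ℝ a (y : Euc n)
        + n * (inner ℝ g (y : Euc n) * inner ℝ a (y : Euc n)) := by
    funext y
    simp only [f₀, action, add_sub_cancel_left, inner_smul_right, inner_sub_right]
    field_simp
    ring
  have hint₀ : ∫ y, f₀ y ∂(uniformSphere n) = inner ℝ g a := by
    rw [hf₀, integral_add, integral_const_mul, integral_const_mul, integral_inner_uniformSphere,
      integral_inner_mul_inner_uniformSphere hn]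
    · field_simp
      ring
    all_goals exact integrable_of_continuous_unitSphere (by fun_prop)
  have hI₀ : Integrable f₀ (uniformSphere n) := by
    rw [hf₀]
    exact integrable_of_continuous_unitSphere (by fun_prop)
  have hI : Integrable (fun y : UnitSphere n => inner ℝ (G.estimate t x y) a)
      (uniformSphere n) := (h.integrable_estimate ht x).inner_const a
  have key : ‖a‖ ^ 2 ≤ B * ‖a‖ := by
    have e : ‖a‖ ^ 2
        = ∫ y : UnitSphere n, (inner ℝ (G.estimate t x y) a - f₀ y) ∂(uniformSphere n) := by
      rw [integral_sub hI hI₀, hint₀, ← h.inner_meanEstimate ht, ← inner_sub_left, ← ha,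
        real_inner_self_eq_norm_sq]
    rw [e]
    have hbound : ∀ y : UnitSphere n, ‖inner ℝ (G.estimate t x y) a - f₀ y‖ ≤ B * ‖a‖ := by
      intro y
      have hy := norm_unitSphere y
      have h1 := (h.payoff t ht).abs_sub_sub_inner_le hx (h.action_mem ht hx hy)
      have h2 := h.norm_action_sub_le ht hx hy
      have e2 : inner ℝ (G.estimate t x y) a - f₀ y
          = n / G.radius t * (G.payoff t (G.action t x y) - G.payoff t x
              - inner ℝ g (G.action t x y - x)) * inner ℝ a (y : Euc n) := by
        simp only [f₀, estimate, real_inner_comm a, real_inner_smul_right]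
        ring
      have h3 : |inner ℝ a (y : Euc n)| ≤ ‖a‖ := by
        simpa [hy] using abs_real_inner_le_norm a (y : Euc n)
      have h4 : |G.payoff t (G.action t x y) - G.payoff t x - inner ℝ g (G.action t x y - x)|
          ≤ |β| * (G.radius t * (1 + D / G.r)) ^ 2 :=
        h1.trans (mul_le_mul (le_abs_self β) (pow_le_pow_left₀ (norm_nonneg _) h2 2)
          (by positivity) (abs_nonneg _))
      rw [e2, Real.norm_eq_abs, abs_mul, abs_mul, abs_of_nonneg (by positivity)]
      calc _ ≤ n / G.radius t * (|β| * (G.radius t * (1 + D / G.r)) ^ 2) * ‖a‖ := by gcongr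
        _ = B * ‖a‖ := by
          simp only [B]
          field_simp
    refine (le_abs_self _).trans ((norm_integral_le_of_norm_le_const (.of_forall hbound)).trans ?_)
    simp
  by_contra! hlt
  nlinarith [norm_nonneg a]

/-! ### Independence and conditional means -/

variable {Ω : Type*} [MeasurableSpace Ω] {μ : Measure Ω}
  {U : ℕ → Ω → UnitSphere n}

theorem measurable_pivot_comp (h : G.IsRegular D V β M) (hU : ∀ t, 1 ≤ t → Measurable (U t))
    (t : ℕ) : Measurable (fun ω => G.pivot (fun s => (U s ω : Euc n)) t) := by
  -- `U 0` need not be measurable, but index `0` is never read.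
  have e : (fun ω => G.pivot (fun s => (U s ω : Euc n)) t)
      = fun ω => G.pivot (fun s => if 1 ≤ s then (U s ω : Euc n) else 0) t := by
    funext ω
    refine G.pivot_congr (t := t) (fun j _ _ q hq => ?_) t le_rfl
    rw [if_pos (head_mem hq).1]
  rw [e]
  refine (h.measurable_pivot t).comp (measurable_pi_lambda _ fun s => ?_)
  by_cases hs : 1 ≤ s
  · simp only [hs, if_true]
    exact measurable_subtype_coe.comp (hU s hs)
  · simp only [hs, if_false]
    exact measurable_const

/-- Until it is dequeued, the direction of a round is independent of all pivots. -/
theorem indepFun_pivot (h : G.IsRegular D V β M) (hU : ∀ t, 1 ≤ t → Measurable (U t))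
    (hind : iIndepFun (fun t => U (t + 1)) μ) {t s : ℕ} (hs : 1 ≤ s)
    (hst : ∀ j, 1 ≤ j → j < t → head G.delay j ≠ s) {m m' : ℕ} (hm : m ≤ t) (hm' : m' ≤ t) :
    IndepFun (fun ω => (G.pivot (fun k => (U k ω : Euc n)) m,
      G.pivot (fun k => (U k ω : Euc n)) m')) (U s) μ := by
  -- Rounds `1, …, t` other than `s`, shifted by one as in `hind`. Padding the missing directions
  -- with `0` leaves the pivots unchanged.
  let S : Finset ℕ := (Finset.range t).erase (s - 1)
  have h1 := hind.indepFun_finset S {s - 1}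
    (by simp [S]) (fun i => hU (i + 1) (by omega))
  let ext : (S → UnitSphere n) → ℕ → Euc n := fun y k =>
    if hk : 1 ≤ k ∧ k - 1 ∈ S then (y ⟨k - 1, hk.2⟩ : Euc n) else 0
  have hext : Measurable ext := by
    refine measurable_pi_lambda _ fun k => ?_
    by_cases hk : 1 ≤ k ∧ k - 1 ∈ S
    · simp only [ext, hk, and_self, dite_true]
      exact measurable_subtype_coe.comp (measurable_pi_apply _)
    · simp only [ext, dif_neg hk]
      exact measurable_const
  have hp : ∀ m ≤ t, ∀ ω, G.pivot (fun k => (U k ω : Euc n)) m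
      = G.pivot (ext fun i => U (i + 1) ω) m := fun m hm ω => by
    refine G.pivot_congr (t := t) (fun j hj hjt q hq => ?_) m hm
    have hqj := head_mem hq
    have hqs : q ≠ s := fun e => hst j hj hjt (e ▸ hq)
    have hk : 1 ≤ q ∧ q - 1 ∈ S := ⟨hqj.1, by
      simp only [S, Finset.mem_erase, Finset.mem_range]
      omega⟩
    simp only [ext, dif_pos hk]
    rw [Nat.sub_add_cancel hqj.1]
  have hψ : Measurable
      (fun y : (({s - 1} : Finset ℕ) → UnitSphere n) => y ⟨s - 1, by simp⟩) :=
    measurable_pi_apply _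
  have h2 := h1.comp (φ := fun y => (G.pivot (ext y) m, G.pivot (ext y) m'))
    (((h.measurable_pivot m).comp hext).prodMk ((h.measurable_pivot m').comp hext)) hψ
  convert h2 using 1
  · funext ω
    simp only [Function.comp]
    rw [hp m hm, hp m' hm']
  · funext ω
    simp [Function.comp, Nat.sub_add_cancel hs]

/-- In the mean, the estimate of a dequeued round can be replaced by its conditional mean. -/
theorem integral_inner_usedEstimate [IsProbabilityMeasure μ] (h : G.IsRegular D V β M)
    (hU : ∀ t, 1 ≤ t → Measurable (U t))
    (hlaw : ∀ t, 1 ≤ t → μ.map (U t) = uniformSphere n)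
    (hind : iIndepFun (fun t => U (t + 1)) μ) {t s : ℕ} (hs : head G.delay t = s)
    (x : Euc n) :
    ∫ ω, inner ℝ (G.usedEstimate (fun k => (U k ω : Euc n)) t)
        (x - G.pivot (fun k => (U k ω : Euc n)) t) ∂μ
      = ∫ ω, inner ℝ (G.meanEstimate s (G.pivot (fun k => (U k ω : Euc n)) s))
        (x - G.pivot (fun k => (U k ω : Euc n)) t) ∂μ := by
  have hs1 := head_mem hs
  have : IsProbabilityMeasure (uniformSphere n) :=
    hlaw s hs1.1 ▸ Measure.isProbabilityMeasure_map (hU s hs1.1).aemeasurable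
  let Z : Ω → Euc n × Euc n := fun ω => (G.pivot (fun k => (U k ω : Euc n)) s,
    G.pivot (fun k => (U k ω : Euc n)) t)
  have hZ : Measurable Z := (h.measurable_pivot_comp hU s).prodMk (h.measurable_pivot_comp hU t)
  have hZU : IndepFun Z (U s) μ := h.indepFun_pivot hU hind hs1.1
    (fun j hj hjt => head_ne_of_lt hj hjt hs) hs1.2 le_rfl
  let Ψ : (Euc n × Euc n) × UnitSphere n → ℝ := fun z =>
    inner ℝ (G.estimate s z.1.1 z.2) (x - z.1.2)
  have hΨ : Measurable Ψ := by
    have hpair : Measurable (fun z : (Euc n × Euc n) × UnitSphere n => (z.1.1, (z.2 : Euc n))) :=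
      (measurable_fst.comp measurable_fst).prodMk (measurable_subtype_coe.comp measurable_snd)
    have hest := (h.measurable_estimate hs1.1).comp hpair
    have hdiff : Measurable (fun z : (Euc n × Euc n) × UnitSphere n => x - z.1.2) :=
      measurable_const.sub (measurable_snd.comp measurable_fst)
    exact hest.inner hdiff
  have hmap := (indepFun_iff_map_prod_eq_prod_map_map hZ.aemeasurable
    (hU s hs1.1).aemeasurable).1 hZU
  rw [hlaw s hs1.1] at hmap
  have hZm : IsProbabilityMeasure (μ.map Z) := Measure.isProbabilityMeasure_map hZ.aemeasurable
  -- `Ψ` is unbounded on the whole product space; pulled back to `Ω` it is bounded, since pivots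
  -- stay in `K`.
  have hΨi : Integrable Ψ ((μ.map Z).prod (uniformSphere n)) := by
    rw [← hmap, integrable_map_measure hΨ.aestronglyMeasurable
      (hZ.prodMk (hU s hs1.1)).aemeasurable]
    refine Integrable.of_bound
      (hΨ.comp (hZ.prodMk (hU s hs1.1))).aestronglyMeasurable
      (n / G.radius s * M * (‖x‖ + ‖G.p‖ + D)) (.of_forall fun ω => ?_)
    refine (norm_inner_le_norm _ _).trans (mul_le_mul
      (h.norm_estimate_le hs1.1 _ (norm_unitSphere _)) ?_ (norm_nonneg _)
      ((norm_nonneg _).trans (h.norm_estimate_le hs1.1 0 (norm_unitSphere (U s ω)))))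
    have h1 := h.norm_sub_le h.p_mem (h.pivot_mem (fun k => (U k ω : Euc n)) t)
    calc ‖x - (Z ω).2‖ = ‖x - G.p + (G.p - (Z ω).2)‖ := by rw [sub_add_sub_cancel]
      _ ≤ ‖x‖ + ‖G.p‖ + D := (norm_add_le _ _).trans (add_le_add (_root_.norm_sub_le _ _) h1)
  calc _ = ∫ ω, Ψ (Z ω, U s ω) ∂μ := by
        refine integral_congr_ae (.of_forall fun ω => ?_)
        simp only [Ψ, Z, G.usedEstimate_of_head_eq _ hs]
    _ = ∫ z, Ψ z ∂((μ.map Z).prod (uniformSphere n)) := by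
        rw [← hmap, integral_map (hZ.prodMk (hU s hs1.1)).aemeasurable hΨ.aestronglyMeasurable]
    _ = ∫ z, inner ℝ (G.meanEstimate s z.1) (x - z.2) ∂(μ.map Z) := by
        rw [integral_prod _ hΨi]
        simp only [Ψ, h.inner_meanEstimate hs1.1]
    _ = _ := by
        rw [integral_map hZ.aemeasurable]
        exact (((h.measurable_meanEstimate hs1.1).comp measurable_fst).inner
          (measurable_const.sub measurable_snd)).aestronglyMeasurable

end IsRegular

end GoldData

/-! ### Sums over the queue -/

/-- The rounds among `1, …, T` at which a reward is dequeued. -/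
def activeRounds (d : ℕ → ℕ) (T : ℕ) : Finset ℕ :=
  (Finset.Icc 1 T).filter fun t => head d t ≠ ⊤

/-- The round whose reward is dequeued at round `t`, as a number (`0` if there is none). -/
def headIndex (d : ℕ → ℕ) (t : ℕ) : ℕ := (head d t).untopD 0

theorem head_eq_headIndex {d : ℕ → ℕ} {T t : ℕ} (ht : t ∈ activeRounds d T) :
    head d t = (headIndex d t : WithTop ℕ) := by
  obtain ⟨s, hs⟩ := WithTop.ne_top_iff_exists.1 (Finset.mem_filter.1 ht).2
  rw [headIndex, ← hs]
  rfl

theorem mem_Icc_of_mem_activeRounds {d : ℕ → ℕ} {T t : ℕ} (ht : t ∈ activeRounds d T) :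
    1 ≤ t ∧ t ≤ T :=
  Finset.mem_Icc.1 (Finset.mem_filter.1 ht).1

theorem headIndex_injOn (d : ℕ → ℕ) (T : ℕ) :
    Set.InjOn (headIndex d) (activeRounds d T) := fun t ht t' ht' h => by
  have h1 := head_eq_headIndex ht
  have h2 := head_eq_headIndex ht'
  rw [← h] at h2
  exact head_injOn (mem_Icc_of_mem_activeRounds ht).1 (mem_Icc_of_mem_activeRounds ht').1 h1 h2

theorem image_headIndex_subset (d : ℕ → ℕ) (T : ℕ) :
    (activeRounds d T).image (headIndex d) ⊆ Finset.Icc 1 T := by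
  intro s hs
  obtain ⟨t, ht, rfl⟩ := Finset.mem_image.1 hs
  have h1 := head_mem (head_eq_headIndex ht)
  exact Finset.mem_Icc.2 ⟨h1.1, h1.2.trans (mem_Icc_of_mem_activeRounds ht).2⟩

/-- No round is dequeued twice. -/
theorem sum_headIndex_le {d : ℕ → ℕ} {T : ℕ} {f : ℕ → ℝ} (hf : ∀ s ∈ Finset.Icc 1 T, 0 ≤ f s) :
    ∑ t ∈ activeRounds d T, f (headIndex d t) ≤ ∑ s ∈ Finset.Icc 1 T, f s := by
  rw [← Finset.sum_image (headIndex_injOn d T)]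
  exact Finset.sum_le_sum_of_subset_of_nonneg (image_headIndex_subset d T)
    fun s hs _ => hf s hs

/-- All but `maxDelay` of the rounds `1, …, T` are dequeued by round `T`. -/
theorem sum_le_sum_headIndex_add {d : ℕ → ℕ} {T : ℕ} {f : ℕ → ℝ} {c : ℝ} (hc : 0 ≤ c)
    (hf : ∀ s ∈ Finset.Icc 1 T, f s ≤ c) :
    ∑ s ∈ Finset.Icc 1 T, f s
      ≤ ∑ t ∈ activeRounds d T, f (headIndex d t) + c * maxDelay d T := by
  rw [← Finset.sum_image (headIndex_injOn d T),
    ← Finset.sum_sdiff (image_headIndex_subset d T), add_comm]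
  refine add_le_add_right ?_ _
  set L := Finset.Icc 1 T \ (activeRounds d T).image (headIndex d)
  have hL : L ⊆ Finset.Ioc (T - maxDelay d T) T := by
    intro s hs
    obtain ⟨hs1, hs2⟩ := Finset.mem_sdiff.1 hs
    rw [Finset.mem_Icc] at hs1
    rw [Finset.mem_Ioc]
    refine ⟨?_, hs1.2⟩
    by_contra! hle
    have h1 := maxDelay_mono d hs1.2
    obtain ⟨t, ht, hts⟩ := exists_head_eq (d := d) (T := T) hs1.1 (by omega)
    refine hs2 (Finset.mem_image.2 ⟨t, Finset.mem_filter.2 ⟨ht, by simp [hts]⟩, ?_⟩)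
    rw [headIndex, hts]
    rfl
  have hcard : L.card ≤ maxDelay d T := by
    have := Finset.card_le_card hL
    rw [Nat.card_Ioc] at this
    omega
  calc ∑ s ∈ L, f s ≤ L.card • c :=
        Finset.sum_le_card_nsmul _ _ _ fun s hs => hf s (Finset.mem_sdiff.1 hs).1
    _ ≤ c * maxDelay d T := by
        rw [nsmul_eq_mul, mul_comm]
        exact mul_le_mul_of_nonneg_left (by exact_mod_cast hcard) hc

/-- After exchanging the sums, a fixed `k` is counted only by rounds `t` with `headIndex d t ≤ k <
t`; the age bound puts these among the `maxDelay d k` rounds following `k`. -/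
theorem sum_sum_Ico_headIndex_le {d : ℕ → ℕ} {T : ℕ} {f : ℕ → ℝ}
    (hf : ∀ s ∈ Finset.Icc 1 T, 0 ≤ f s) :
    ∑ t ∈ activeRounds d T, ∑ k ∈ Finset.Ico (headIndex d t) t, f k
      ≤ ∑ k ∈ Finset.Icc 1 T, f k * maxDelay d k := by
  rw [Finset.sum_comm' (t' := Finset.Icc 1 T)
    (s' := fun k => (activeRounds d T).filter fun t => headIndex d t ≤ k ∧ k < t)]
  · refine Finset.sum_le_sum fun k hk => ?_
    rw [Finset.sum_const, nsmul_eq_mul, mul_comm]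
    refine mul_le_mul_of_nonneg_left ?_ (hf k hk)
    have hsub : ((activeRounds d T).filter fun t => headIndex d t ≤ k ∧ k < t)
        ⊆ Finset.Ioc k (k + maxDelay d k) := by
      intro t ht
      obtain ⟨ht, h1, h2⟩ := Finset.mem_filter.1 ht
      have h3 := le_head_add_maxDelay (mem_Icc_of_mem_activeRounds ht).1 (head_eq_headIndex ht)
      have h4 := maxDelay_mono d h1
      rw [Finset.mem_Ioc]
      omega
    have := Finset.card_le_card hsub
    rw [Nat.card_Ioc, Nat.add_sub_cancel_left] at this
    exact_mod_cast this
  · intro t k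
    simp only [Finset.mem_filter, Finset.mem_Ico, Finset.mem_Icc]
    constructor
    · rintro ⟨ht, h1, h2⟩
      have h3 := head_mem (head_eq_headIndex ht)
      have h4 := mem_Icc_of_mem_activeRounds ht
      exact ⟨⟨ht, h1, h2⟩, by omega, by omega⟩
    · rintro ⟨⟨ht, h1, h2⟩, -⟩
      exact ⟨ht, h1, h2⟩

/-! ### The regret bound for general step sizes and sampling radii -/

namespace GoldData.IsRegular

variable {n : ℕ} {G : GoldData n} {D V β M : ℝ} {Ω : Type*} [MeasurableSpace Ω] {μ : Measure Ω}
  {U : ℕ → Ω → UnitSphere n}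

theorem measurable_usedEstimate_comp (h : G.IsRegular D V β M)
    (hU : ∀ t, 1 ≤ t → Measurable (U t)) (t : ℕ) :
    Measurable (fun ω => G.usedEstimate (fun s => (U s ω : Euc n)) t) := by
  rcases hq : head G.delay t with _ | q
  · simp only [G.usedEstimate_of_head_eq_top _ hq]
    exact measurable_const
  · have hqm := head_mem hq
    have hq' : ∀ ω, G.usedEstimate (fun s => (U s ω : Euc n)) t
        = G.estimate q (G.pivot (fun s => (U s ω : Euc n)) q) (U q ω) := fun ω =>
      G.usedEstimate_of_head_eq _ hq
    have hpair : Measurable (fun ω => (G.pivot (fun s => (U s ω : Euc n)) q, (U q ω : Euc n))) :=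
      (h.measurable_pivot_comp hU q).prodMk (measurable_subtype_coe.comp (hU q hqm.1))
    have hcomp := (h.measurable_estimate hqm.1).comp hpair
    rw [funext hq']
    exact hcomp

theorem measurable_played_comp (h : G.IsRegular D V β M)
    (hU : ∀ t, 1 ≤ t → Measurable (U t)) {t : ℕ} (ht : 1 ≤ t) :
    Measurable (fun ω => G.played (fun s => (U s ω : Euc n)) t) := by
  have hpair : Measurable (fun ω => (G.pivot (fun s => (U s ω : Euc n)) t, (U t ω : Euc n))) :=
    (h.measurable_pivot_comp hU t).prodMk (measurable_subtype_coe.comp (hU t ht))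
  have hcomp := (measurable_action (G := G) t).comp hpair
  exact hcomp

theorem integrable_payoff_comp [IsFiniteMeasure μ] (h : G.IsRegular D V β M) {t : ℕ}
    (ht : 1 ≤ t) {A : Ω → Euc n} (hA : Measurable A) :
    Integrable (fun ω => G.payoff t (A ω)) μ :=
  Integrable.of_bound ((h.measurable_payoff t ht).comp hA).aestronglyMeasurable M
    (.of_forall fun ω => h.abs_payoff_le t ht (A ω))

theorem integrable_inner_usedEstimate [IsFiniteMeasure μ] (h : G.IsRegular D V β M)
    (hU : ∀ t, 1 ≤ t → Measurable (U t)) {t : ℕ} (ht : 1 ≤ t) {x : Euc n} (hx : x ∈ G.K) :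
    Integrable (fun ω => inner ℝ (G.usedEstimate (fun k => (U k ω : Euc n)) t)
      (x - G.pivot (fun k => (U k ω : Euc n)) t)) μ := by
  refine Integrable.of_bound ((h.measurable_usedEstimate_comp hU t).inner
    (measurable_const.sub (h.measurable_pivot_comp hU t))).aestronglyMeasurable
    (n / G.radius t * M * D) (.of_forall fun ω => ?_)
  have h0 := h.radius_pos t ht
  have hM := h.M_nonneg
  exact (norm_inner_le_norm _ _).trans (mul_le_mul
    (h.norm_usedEstimate_le (fun s => norm_unitSphere _) ht)
    (h.norm_sub_le hx (h.pivot_mem _ t)) (norm_nonneg _) (by positivity))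

/-- Uniform in `t`, unlike the bound on the estimate itself: this keeps the drift cost at one factor
`1 / δ_k` instead of two. -/
theorem norm_meanEstimate_le [IsProbabilityMeasure (uniformSphere n)] (hn : 1 ≤ n)
    (h : G.IsRegular D V β M) {t : ℕ} (ht : 1 ≤ t) {x : Euc n} (hx : x ∈ G.K) :
    ‖G.meanEstimate t x‖ ≤ V + n * |β| * (1 + D / G.r) ^ 2 * G.r := by
  have h1 := h.norm_meanEstimate_sub_le hn ht hx
  have h2 := (h.payoff t ht).grad_bound x hx
  have h3 := h.radius_le t ht
  have h4 := norm_le_norm_add_norm_sub' (G.meanEstimate t x) (gradientWithin (G.payoff t) G.K x)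
  have h5 : n * |β| * (1 + D / G.r) ^ 2 * G.radius t ≤ n * |β| * (1 + D / G.r) ^ 2 * G.r := by
    gcongr
  linarith

/-- The regret of a dequeued round, in terms of the mean gradient estimate. -/
theorem payoff_sub_le [IsProbabilityMeasure (uniformSphere n)] (hn : 1 ≤ n)
    (h : G.IsRegular D V β M) {w : ℕ → Euc n} (hw : ∀ t, ‖w t‖ = 1) {t s : ℕ} (hs : 1 ≤ s)
    (hst : s ≤ t) {x : Euc n} (hx : x ∈ G.K) :
    G.payoff s x - G.payoff s (G.pivot w s)
      ≤ inner ℝ (G.meanEstimate s (G.pivot w s)) (x - G.pivot w t)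
        + n * |β| * (1 + D / G.r) ^ 2 * G.radius s * D
        + ∑ k ∈ Finset.Ico s t, (V + n * |β| * (1 + D / G.r) ^ 2 * G.r)
          * (G.step k * (n / G.radius k * M)) := by
  have hXs := h.pivot_mem w s
  have h1 := (h.payoff s hs).sub_le_inner hXs hx
  have h2 := h.norm_meanEstimate_sub_le hn hs hXs
  have h3 := h.norm_meanEstimate_le hn hs hXs
  have h4 := h.norm_sub_le hx hXs
  set g := gradientWithin (G.payoff s) G.K (G.pivot w s)
  set m := G.meanEstimate s (G.pivot w s)
  set W := V + n * |β| * (1 + D / G.r) ^ 2 * G.r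
  have hW : 0 ≤ W := (norm_nonneg _).trans h3
  have hB := (norm_nonneg _).trans h2
  -- Mean estimate at the current pivot, plus bias, plus drift.
  have e : inner ℝ g (x - G.pivot w s) = inner ℝ m (x - G.pivot w t)
      + inner ℝ (g - m) (x - G.pivot w s) + inner ℝ m (G.pivot w t - G.pivot w s) := by
    simp only [inner_sub_left, inner_sub_right]
    ring
  have h5 : inner ℝ (g - m) (x - G.pivot w s)
      ≤ n * |β| * (1 + D / G.r) ^ 2 * G.radius s * D :=
    (real_inner_le_norm _ _).trans (mul_le_mul (by rwa [norm_sub_rev]) h4 (norm_nonneg _) hB)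
  have h6 : inner ℝ m (G.pivot w t - G.pivot w s)
      ≤ ∑ k ∈ Finset.Ico s t, W * (G.step k * (n / G.radius k * M)) := by
    refine (real_inner_le_norm _ _).trans ((mul_le_mul h3 (h.norm_pivot_sub_le w hs hst)
      (norm_nonneg _) hW).trans ?_)
    rw [Finset.mul_sum]
    refine Finset.sum_le_sum fun k hk => ?_
    have hk1 : 1 ≤ k := hs.trans (Finset.mem_Ico.1 hk).1
    exact mul_le_mul_of_nonneg_left (mul_le_mul_of_nonneg_left (h.norm_usedEstimate_le hw hk1)
      (h.step_pos k hk1).le) hW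
  linarith

/-- The right side collects, in order, energy, variance, bias, drift and pending rounds; each
pending round costs at most `2 * M`. -/
theorem sum_integral_payoff_sub_le [IsProbabilityMeasure μ] (hn : 1 ≤ n)
    (h : G.IsRegular D V β M) (hU : ∀ t, 1 ≤ t → Measurable (U t))
    (hlaw : ∀ t, 1 ≤ t → μ.map (U t) = uniformSphere n)
    (hind : iIndepFun (fun t => U (t + 1)) μ) {T : ℕ} (hT : 1 ≤ T) {x : Euc n} (hx : x ∈ G.K) :
    ∑ t ∈ Finset.Icc 1 T,
        ∫ ω, (G.payoff t x - G.payoff t (G.pivot (fun s => (U s ω : Euc n)) t)) ∂μ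
      ≤ D ^ 2 / (2 * G.step T)
        + ∑ t ∈ Finset.Icc 1 T, G.step t * (n / G.radius t * M) ^ 2 / 2
        + ∑ t ∈ Finset.Icc 1 T, n * |β| * (1 + D / G.r) ^ 2 * G.radius t * D
        + ∑ t ∈ Finset.Icc 1 T, (V + n * |β| * (1 + D / G.r) ^ 2 * G.r)
          * (G.step t * (n / G.radius t * M)) * maxDelay G.delay t
        + 2 * M * maxDelay G.delay T := by
  have : IsProbabilityMeasure (uniformSphere n) :=
    hlaw 1 le_rfl ▸ Measure.isProbabilityMeasure_map (hU 1 le_rfl).aemeasurable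
  have hM := h.M_nonneg
  have hD := h.D_nonneg
  have hV := h.V_nonneg
  have hr := h.r_pos
  let X : ℕ → Ω → Euc n := fun t ω => G.pivot (fun s => (U s ω : Euc n)) t
  let v : ℕ → Ω → Euc n := fun t ω => G.usedEstimate (fun s => (U s ω : Euc n)) t
  let gap : ℕ → ℝ := fun t => ∫ ω, (G.payoff t x - G.payoff t (X t ω)) ∂μ
  let B : ℕ → ℝ := fun t => n * |β| * (1 + D / G.r) ^ 2 * G.radius t * D
  let F : ℕ → ℝ := fun t => (V + n * |β| * (1 + D / G.r) ^ 2 * G.r)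
    * (G.step t * (n / G.radius t * M))
  have hw : ∀ ω t, ‖(U t ω : Euc n)‖ = 1 := fun ω t => norm_unitSphere _
  have hXm : ∀ t, Measurable (X t) := fun t => h.measurable_pivot_comp hU t
  have hgapi : ∀ t, 1 ≤ t → Integrable (fun ω => G.payoff t x - G.payoff t (X t ω)) μ :=
    fun t ht => (integrable_const _).sub (h.integrable_payoff_comp ht (hXm t))
  have hgap : ∀ t ∈ Finset.Icc 1 T, gap t ≤ 2 * M := fun t ht => by
    have ht1 := (Finset.mem_Icc.1 ht).1
    refine (integral_mono (hgapi t ht1) (integrable_const (2 * M)) fun ω => ?_).trans_eq (by simp)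
    have h1 := abs_le.1 (h.abs_payoff_le t ht1 x)
    have h2 := abs_le.1 (h.abs_payoff_le t ht1 (X t ω))
    change G.payoff t x - G.payoff t (X t ω) ≤ 2 * M
    linarith
  have hB : ∀ t ∈ Finset.Icc 1 T, 0 ≤ B t := fun t ht => by
    have := h.radius_pos t (Finset.mem_Icc.1 ht).1
    positivity
  have hF : ∀ t ∈ Finset.Icc 1 T, 0 ≤ F t := fun t ht => by
    have := h.radius_pos t (Finset.mem_Icc.1 ht).1
    have := h.step_pos t (Finset.mem_Icc.1 ht).1
    positivity
  have hvi : ∀ t, 1 ≤ t → Integrable (fun ω => inner ℝ (v t ω) (x - X t ω)) μ :=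
    fun t ht => h.integrable_inner_usedEstimate hU ht hx
  have hstep : ∀ t ∈ activeRounds G.delay T, gap (headIndex G.delay t)
      ≤ ∫ ω, inner ℝ (v t ω) (x - X t ω) ∂μ + B (headIndex G.delay t)
        + ∑ k ∈ Finset.Ico (headIndex G.delay t) t, F k := fun t ht => by
    have hs := head_eq_headIndex ht
    set s := headIndex G.delay t
    have hs1 := head_mem hs
    rw [h.integral_inner_usedEstimate hU hlaw hind hs x, add_assoc]
    have hmi : Integrable (fun ω => inner ℝ (G.meanEstimate s (X s ω)) (x - X t ω)) μ := by
      refine Integrable.of_bound (((h.measurable_meanEstimate hs1.1).comp (hXm s)).inner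
        (measurable_const.sub (hXm t))).aestronglyMeasurable
        ((V + n * |β| * (1 + D / G.r) ^ 2 * G.r) * D) (.of_forall fun ω => ?_)
      exact (norm_inner_le_norm _ _).trans (mul_le_mul
        (h.norm_meanEstimate_le hn hs1.1 (h.pivot_mem _ s))
        (h.norm_sub_le hx (h.pivot_mem _ t)) (norm_nonneg _) (by positivity))
    refine (integral_mono (hgapi s hs1.1) (hmi.add (integrable_const
      (B s + ∑ k ∈ Finset.Ico s t, F k))) fun ω => ?_).trans_eq ?_
    · have := h.payoff_sub_le hn (hw ω) hs1.1 hs1.2 hx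
      rw [add_assoc] at this
      exact this
    · simp only [Pi.add_apply]
      rw [integral_add hmi (integrable_const _)]
      simp [X]
  have hmain : ∑ t ∈ activeRounds G.delay T, ∫ ω, inner ℝ (v t ω) (x - X t ω) ∂μ
      ≤ D ^ 2 / (2 * G.step T)
        + ∑ t ∈ Finset.Icc 1 T, G.step t * (n / G.radius t * M) ^ 2 / 2 := by
    have e : ∑ t ∈ activeRounds G.delay T, ∫ ω, inner ℝ (v t ω) (x - X t ω) ∂μ
        = ∑ t ∈ Finset.Icc 1 T, ∫ ω, inner ℝ (v t ω) (x - X t ω) ∂μ := by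
      rw [activeRounds, Finset.sum_filter]
      refine Finset.sum_congr rfl fun t _ => ?_
      by_cases ht : head G.delay t = ⊤
      · simp [ht, v, G.usedEstimate_of_head_eq_top _ ht]
      · simp [ht]
    rw [e, ← integral_finsetSum _ fun t ht => hvi t (Finset.mem_Icc.1 ht).1]
    refine (integral_mono (integrable_finsetSum _ fun t ht => hvi t (Finset.mem_Icc.1 ht).1)
      (integrable_const (D ^ 2 / (2 * G.step T)
        + ∑ t ∈ Finset.Icc 1 T, G.step t * (n / G.radius t * M) ^ 2 / 2))
      fun ω => ?_).trans_eq (by simp)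
    refine (h.sum_inner_usedEstimate_le (fun s => (U s ω : Euc n)) hT hx).trans
      (add_le_add_right (Finset.sum_le_sum fun t ht => ?_) _)
    have ht1 := (Finset.mem_Icc.1 ht).1
    have h1 := h.norm_usedEstimate_le (hw ω) ht1
    have h2 := h.step_pos t ht1
    gcongr
  calc ∑ t ∈ Finset.Icc 1 T, gap t
      ≤ ∑ t ∈ activeRounds G.delay T, gap (headIndex G.delay t)
        + 2 * M * maxDelay G.delay T := sum_le_sum_headIndex_add (by positivity) hgap
    _ ≤ ∑ t ∈ activeRounds G.delay T, (∫ ω, inner ℝ (v t ω) (x - X t ω) ∂μ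
          + B (headIndex G.delay t) + ∑ k ∈ Finset.Ico (headIndex G.delay t) t, F k)
        + 2 * M * maxDelay G.delay T := add_le_add_left (Finset.sum_le_sum hstep) _
    _ ≤ _ := by
        rw [Finset.sum_add_distrib, Finset.sum_add_distrib]
        exact add_le_add_left (add_le_add (add_le_add hmain (sum_headIndex_le hB))
          (sum_sum_Ico_headIndex_le hF)) _

theorem abs_payoff_played_sub_le (h : G.IsRegular D V β M) {w : ℕ → Euc n}
    (hw : ∀ t, ‖w t‖ = 1) {t : ℕ} (ht : 1 ≤ t) :
    |G.payoff t (G.played w t) - G.payoff t (G.pivot w t)|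
      ≤ V * (1 + D / G.r) * G.radius t := by
  have hX := h.pivot_mem w t
  refine ((h.payoff t ht).abs_sub_le hX (h.action_mem ht hX (hw t))).trans ?_
  refine (mul_le_mul_of_nonneg_left (h.norm_action_sub_le ht hX (hw t)) h.V_nonneg).trans_eq ?_
  ring

end GoldData.IsRegular

/-! ### Rates -/

/-- Bernoulli's inequality for exponents at most `1` bounds each term by an increment of `t ^ c /
c`. -/
theorem sum_Icc_rpow_sub_one_le {c : ℝ} (h0 : 0 < c) (h1 : c ≤ 1) (T : ℕ) :
    ∑ t ∈ Finset.Icc 1 T, (t : ℝ) ^ (c - 1) ≤ (T : ℝ) ^ c / c := by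
  induction T with
  | zero => simp [Real.zero_rpow h0.ne']
  | succ T ih =>
    rw [Finset.sum_Icc_succ_top (by omega)]
    have hT : (0 : ℝ) < ((T + 1 : ℕ) : ℝ) := by positivity
    set τ : ℝ := ((T + 1 : ℕ) : ℝ) with hτ
    have hT' : (T : ℝ) = τ * (1 + -(1 / τ)) := by
      rw [hτ]
      push_cast
      field_simp
      ring
    have hτ1 : 1 / τ ≤ 1 := by
      rw [div_le_one hT, hτ]
      push_cast
      linarith [Nat.cast_nonneg (α := ℝ) T]
    have hb := rpow_one_add_le_one_add_mul_self (s := -(1 / τ)) (by linarith) h0.le h1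
    have hpow : (T : ℝ) ^ c ≤ τ ^ c - c * τ ^ (c - 1) := by
      rw [hT', Real.mul_rpow hT.le (by linarith), Real.rpow_sub_one hT.ne']
      refine (mul_le_mul_of_nonneg_left hb (by positivity)).trans_eq ?_
      ring
    have : (T : ℝ) ^ c / c ≤ τ ^ c / c - τ ^ (c - 1) := by
      rw [div_le_iff₀ h0, sub_mul, div_mul_cancel₀ _ h0.ne']
      linarith
    linarith

/-- The sampling exponent is `1` minus the step exponent. -/
theorem min_eq_one_sub_max (α : ℝ) :
    min (1 / 4 : ℝ) (1 / 3 - α / 3) = 1 - max (3 / 4 : ℝ) (2 / 3 + α / 3) := by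
  rw [show (1 / 4 : ℝ) = 1 - 3 / 4 by norm_num,
    show 1 / 3 - α / 3 = 1 - (2 / 3 + α / 3) by ring]
  exact min_sub_sub_left _ _ _

/-- All contributions to the regret bound are of order `T ^ c`. -/
theorem tuned_rates {N D r V B M γ δ A a c : ℝ} {m : ℕ → ℕ} (hN : 0 ≤ N) (hD : 0 ≤ D)
    (hr : 0 < r) (hV : 0 ≤ V) (hB : 0 ≤ B) (hM : 0 ≤ M) (hγ : 0 < γ) (hδ : 0 < δ) (hA : 0 ≤ A)
    (hc0 : 3 / 4 ≤ c) (hc1 : c ≤ 1) (hac : 2 + a ≤ 3 * c)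
    (hm : ∀ t : ℕ, 1 ≤ t → (m t : ℝ) ≤ A * (t : ℝ) ^ a) {T : ℕ} (hT : 1 ≤ T) :
    D ^ 2 / (2 * (γ / (T : ℝ) ^ c))
        + ∑ t ∈ Finset.Icc 1 T,
            γ / (t : ℝ) ^ c * (N / (δ / (t : ℝ) ^ (1 - c)) * M) ^ 2 / 2
        + ∑ t ∈ Finset.Icc 1 T, B * (δ / (t : ℝ) ^ (1 - c)) * D
        + ∑ t ∈ Finset.Icc 1 T, (V + B * r)
          * (γ / (t : ℝ) ^ c * (N / (δ / (t : ℝ) ^ (1 - c)) * M)) * m t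
        + 2 * M * m T
        + ∑ t ∈ Finset.Icc 1 T, V * (1 + D / r) * (δ / (t : ℝ) ^ (1 - c))
      ≤ (D ^ 2 / (2 * γ) + γ * (N / δ * M) ^ 2 / 2 / c + B * δ * D / c
        + (V + B * r) * γ * (N / δ * M) * A / c + 2 * M * A + V * (1 + D / r) * δ / c)
          * (T : ℝ) ^ c := by
  have hc : 0 < c := by linarith
  have hsum : ∀ (E : ℝ) (f : ℕ → ℝ), 0 ≤ E → (∀ t : ℕ, 1 ≤ t → f t ≤ E * (t : ℝ) ^ (c - 1)) →
      ∑ t ∈ Finset.Icc 1 T, f t ≤ E / c * (T : ℝ) ^ c := fun E f hE hf => by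
    calc _ ≤ ∑ t ∈ Finset.Icc 1 T, E * (t : ℝ) ^ (c - 1) :=
          Finset.sum_le_sum fun t ht => hf t (Finset.mem_Icc.1 ht).1
      _ = E * ∑ t ∈ Finset.Icc 1 T, (t : ℝ) ^ (c - 1) := by rw [Finset.mul_sum]
      _ ≤ E * ((T : ℝ) ^ c / c) :=
          mul_le_mul_of_nonneg_left (sum_Icc_rpow_sub_one_le hc hc1 T) hE
      _ = _ := by ring
  have hinv : ∀ t : ℝ, 1 ≤ t → 1 / t ^ (1 - c) = t ^ (c - 1) := fun t ht => by
    rw [one_div, ← Real.rpow_neg (by linarith), neg_sub]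
  have hdiv : ∀ t : ℝ, 1 ≤ t → t ^ (1 - c) / t ^ c = t ^ (1 - 2 * c) := fun t ht => by
    rw [← Real.rpow_sub (by linarith)]
    ring_nf
  have h1 : D ^ 2 / (2 * (γ / (T : ℝ) ^ c)) = D ^ 2 / (2 * γ) * (T : ℝ) ^ c := by
    have : (0 : ℝ) < (T : ℝ) ^ c := Real.rpow_pos_of_pos (by exact_mod_cast hT) _
    field_simp
  -- Variance: the exponent `2 - 3 * c` is at most `c - 1` exactly when `c ≥ 3 / 4`.
  have h2 := hsum (γ * (N / δ * M) ^ 2 / 2)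
    (fun t => γ / (t : ℝ) ^ c * (N / (δ / (t : ℝ) ^ (1 - c)) * M) ^ 2 / 2) (by positivity)
    fun t ht => by
      have ht1 : (1 : ℝ) ≤ t := by exact_mod_cast ht
      have e : γ / (t : ℝ) ^ c * (N / (δ / (t : ℝ) ^ (1 - c)) * M) ^ 2 / 2
          = γ * (N / δ * M) ^ 2 / 2 * ((t : ℝ) ^ (1 - c) * ((t : ℝ) ^ (1 - c) / (t : ℝ) ^ c)) := by
        rw [div_div_eq_mul_div]
        ring
      simp only [e]
      rw [hdiv _ ht1, ← Real.rpow_add (by linarith)]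
      exact mul_le_mul_of_nonneg_left
        (Real.rpow_le_rpow_of_exponent_le ht1 (by linarith)) (by positivity)
  have h3 := hsum (B * δ * D) (fun t => B * (δ / (t : ℝ) ^ (1 - c)) * D) (by positivity)
    fun t ht => by
      rw [← hinv _ (by exact_mod_cast ht)]
      exact le_of_eq (by ring)
  -- Drift: the exponent `1 - 2 * c + a` is at most `c - 1` by `hac`.
  have h4 := hsum ((V + B * r) * γ * (N / δ * M) * A)
    (fun t => (V + B * r) * (γ / (t : ℝ) ^ c * (N / (δ / (t : ℝ) ^ (1 - c)) * M)) * m t)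
    (by positivity) fun t ht => by
      have ht1 : (1 : ℝ) ≤ t := by exact_mod_cast ht
      have e : (V + B * r) * (γ / (t : ℝ) ^ c * (N / (δ / (t : ℝ) ^ (1 - c)) * M)) * m t
          = (V + B * r) * γ * (N / δ * M) * ((t : ℝ) ^ (1 - c) / (t : ℝ) ^ c) * m t := by
        rw [div_div_eq_mul_div]
        ring
      simp only [e]
      rw [hdiv _ ht1]
      refine (mul_le_mul_of_nonneg_left (hm t ht) (by positivity)).trans ?_
      have h5 : (t : ℝ) ^ (1 - 2 * c) * (t : ℝ) ^ a ≤ (t : ℝ) ^ (c - 1) := by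
        rw [← Real.rpow_add (by linarith)]
        exact Real.rpow_le_rpow_of_exponent_le ht1 (by linarith)
      refine le_trans (le_of_eq ?_) (mul_le_mul_of_nonneg_left h5
        (show 0 ≤ (V + B * r) * γ * (N / δ * M) * A by positivity))
      ring
  have h5 : 2 * M * m T ≤ 2 * M * A * (T : ℝ) ^ c := by
    have hT1 : (1 : ℝ) ≤ T := by exact_mod_cast hT
    have h6 : (T : ℝ) ^ a ≤ (T : ℝ) ^ c :=
      Real.rpow_le_rpow_of_exponent_le hT1 (by linarith)
    calc _ ≤ 2 * M * (A * (T : ℝ) ^ c) := mul_le_mul_of_nonneg_left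
          ((hm T hT).trans (mul_le_mul_of_nonneg_left h6 hA)) (by positivity)
      _ = _ := by ring
  have h6 := hsum (V * (1 + D / r) * δ)
    (fun t => V * (1 + D / r) * (δ / (t : ℝ) ^ (1 - c))) (by positivity) fun t ht => by
      rw [← hinv _ (by exact_mod_cast ht)]
      exact le_of_eq (by ring)
  rw [h1]
  linarith

/-- The tuned policy, with the payoffs extended by projection. -/
theorem isRegular_tunedGold {n : ℕ} {D r V β M γ δ α : ℝ} (hr : 0 < r) (hγ : 0 < γ) (hδ : 0 < δ)
    (hδr : δ ≤ r) (hα : α < 1) (d : ℕ → ℕ) {K : Set (Euc n)} {p x₁ : Euc n}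
    {u : ℕ → Euc n → ℝ} (hK : IsCompact K) (hc : Convex ℝ K) (hD : diam K ≤ D)
    (hb : closedBall p r ⊆ K) (hx : x₁ ∈ K) (hu : ∀ t, 1 ≤ t → IsPayoff K V β M (u t)) :
    (tunedGold γ δ α K p r x₁ (fun t x => u t (euclProj K x)) d).IsRegular D V β M := by
  have hexp : 0 < min (1 / 4 : ℝ) (1 / 3 - α / 3) := lt_min (by norm_num) (by linarith)
  have hexp' : 0 < max (3 / 4 : ℝ) (2 / 3 + α / 3) := lt_max_of_lt_left (by norm_num)
  have hpos : ∀ t : ℕ, 1 ≤ t → (1 : ℝ) ≤ t := fun t ht => by exact_mod_cast ht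
  have hmem : ∀ x, euclProj K x ∈ K := euclProj_mem hK hc ⟨_, hx⟩
  refine ⟨hr, hK, hc, hD, hb, hx, fun t ht => ?_, fun t ht => ?_, fun t ht x => ?_, fun t ht => ?_,
    fun t ht => ?_, fun s t hs hst => ?_, fun t ht => ?_, fun t ht => ?_⟩
  · exact (hu t ht).congr fun x hx => by simp only [tunedGold, euclProj_of_mem hK hc hx]
  · exact ((hu t ht).continuousOn.comp_continuous (continuous_euclProj hK hc ⟨_, hx⟩)
      hmem).measurable
  · exact (hu t ht).bounded _ (hmem x)
  · exact div_pos hδ (Real.rpow_pos_of_pos (by linarith [hpos t ht]) _)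
  · exact (div_le_self hδ.le (Real.one_le_rpow (hpos t ht) hexp.le)).trans hδr
  · exact div_le_div_of_nonneg_left hδ.le
      (Real.rpow_pos_of_pos (by linarith [hpos s hs]) _)
      (Real.rpow_le_rpow (by positivity) (by exact_mod_cast hst) hexp.le)
  · exact div_pos hγ (Real.rpow_pos_of_pos (by linarith [hpos t ht]) _)
  · exact div_le_div_of_nonneg_left hγ.le
      (Real.rpow_pos_of_pos (by linarith [hpos t ht]) _)
      (Real.rpow_le_rpow (by positivity) (by push_cast; linarith) hexp'.le)

/-! ### Attainment of the maximum and the final bound -/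

theorem expectedRegret_eq {n : ℕ} {Ω : Type*} [MeasurableSpace Ω] {μ : Measure Ω}
    [IsProbabilityMeasure μ] {u : ℕ → Euc n → ℝ} {A : ℕ → Ω → Euc n} {T : ℕ}
    (hA : ∀ t, 1 ≤ t → Integrable (fun ω => u t (A t ω)) μ) (x : Euc n) :
    expectedRegret μ u A T x = ∑ t ∈ Finset.Icc 1 T, (u t x - ∫ ω, u t (A t ω) ∂μ) := by
  rw [expectedRegret, integral_finsetSum (f := fun t ω => u t x - u t (A t ω)) _ fun t ht =>
    (integrable_const _).sub (hA t (Finset.mem_Icc.1 ht).1)]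
  refine Finset.sum_congr rfl fun t ht => ?_
  rw [integral_sub (integrable_const _) (hA t (Finset.mem_Icc.1 ht).1)]
  simp

theorem isGreatest_meanRegret {n : ℕ} {Ω : Type*} [MeasurableSpace Ω] {μ : Measure Ω}
    [IsProbabilityMeasure μ] {K : Set (Euc n)} {u : ℕ → Euc n → ℝ} {A : ℕ → Ω → Euc n}
    (hK : IsCompact K) (hne : K.Nonempty) (hu : ∀ t, 1 ≤ t → ContinuousOn (u t) K)
    (hA : ∀ t, 1 ≤ t → Integrable (fun ω => u t (A t ω)) μ) (T : ℕ) :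
    IsGreatest (expectedRegret μ u A T '' K) (meanRegret μ K u A T) := by
  refine (hK.image_of_continuousOn ?_).isGreatest_sSup (hne.image _)
  rw [funext (expectedRegret_eq hA)]
  exact continuousOn_finsetSum _ fun t ht =>
    (hu t (Finset.mem_Icc.1 ht).1).sub continuousOn_const

theorem mainTheorem1
    (n : ℕ) (hn : 1 ≤ n) (D r V β M γ δ α : ℝ)
    (hr : 0 < r) (hγ : 0 < γ) (hδ : 0 < δ) (hδr : δ ≤ r) (hα : α < 1)
    (d : ℕ → ℕ)
    (hd : (fun t : ℕ => (d t : ℝ)) =o[atTop] (fun t : ℕ => (t : ℝ) ^ α)) :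
    ∃ (C : ℝ) (k : ℕ),
      ∀ (K : Set (Euc n)) (p x₁ : Euc n) (u : ℕ → Euc n → ℝ)
        {Ω : Type*} [MeasurableSpace Ω] (μ : Measure Ω) [IsProbabilityMeasure μ]
        (U : ℕ → Ω → UnitSphere n),
        IsCompact K → Convex ℝ K → diam K ≤ D → closedBall p r ⊆ K → x₁ ∈ K →
        (∀ t, 1 ≤ t → IsPayoff K V β M (u t)) →
        (∀ t, 1 ≤ t → Measurable (U t)) →
        (∀ t, 1 ≤ t → μ.map (U t) = uniformSphere n) →
        iIndepFun (fun t => U (t + 1)) μ →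
        ∀ A : ℕ → Ω → Euc n,
          -- the played actions, or the pivots
          (A = (fun t ω => (tunedGold γ δ α K p r x₁ u d).played (fun s => (U s ω : Euc n)) t) ∨
           A = (fun t ω => (tunedGold γ δ α K p r x₁ u d).pivot (fun s => (U s ω : Euc n)) t)) →
          (∀ t, 1 ≤ t → Integrable (fun ω => u t (A t ω)) μ) ∧
          ∀ T : ℕ, 1 ≤ T →
            IsGreatest (expectedRegret μ u A T '' K) (meanRegret μ K u A T) ∧
            meanRegret μ K u A T ≤
              C * (1 + Real.log T) ^ k *
                ((T : ℝ) ^ (3 / 4 : ℝ) + (T : ℝ) ^ (2 / 3 + α / 3)) := by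
  obtain ⟨A₀, hA₀, hmax⟩ := exists_maxDelay_le hd
  set c : ℝ := max (3 / 4 : ℝ) (2 / 3 + α / 3) with hc
  have hc0 : 3 / 4 ≤ c := le_max_left _ _
  have hc1 : c ≤ 1 := max_le (by norm_num) (by linarith)
  have hac : 2 + max α 0 ≤ 3 * c := by
    have := le_max_right (3 / 4 : ℝ) (2 / 3 + α / 3)
    rcases max_cases α 0 with h | h <;> linarith
  let B : ℝ := n * |β| * (1 + D / r) ^ 2
  refine ⟨D ^ 2 / (2 * γ) + γ * (n / δ * M) ^ 2 / 2 / c + B * δ * D / c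
    + (V + B * r) * γ * (n / δ * M) * A₀ / c + 2 * M * A₀ + V * (1 + D / r) * δ / c, 0, ?_⟩
  intro K p x₁ u Ω _ μ _ U hK hcv hdiam hball hx₁ hu hU hlaw hind A hA
  -- Composing with the projection makes the payoffs measurable and bounded everywhere; the run only
  -- evaluates them on `K`, so it is unchanged.
  let u' : ℕ → Euc n → ℝ := fun t x => u t (euclProj K x)
  let G : GoldData n := tunedGold γ δ α K p r x₁ u' d
  have h : G.IsRegular D V β M :=
    isRegular_tunedGold hr hγ hδ hδr hα d hK hcv hdiam hball hx₁ hu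
  have hD := h.D_nonneg
  have hV := h.V_nonneg
  have hM := h.M_nonneg
  have huu' : ∀ t, ∀ x ∈ K, u' t x = u t x := fun t x hx => by
    simp only [u', euclProj_of_mem hK hcv hx]
  have hw : ∀ ω t, ‖(U t ω : Euc n)‖ = 1 := fun ω t => norm_unitSphere _
  have hpiv : ∀ t ω, (tunedGold γ δ α K p r x₁ u d).pivot (fun s => (U s ω : Euc n)) t
      = G.pivot (fun s => (U s ω : Euc n)) t := fun t ω =>
    ((tunedGold γ δ α K p r x₁ u d).pivot_congr_payoff u' hK hcv hr hball hx₁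
      (fun t ht => ⟨(h.radius_pos t ht).le, h.radius_le t ht⟩)
      (fun t _ x hx => huu' t x hx) (hw ω) t).symm
  -- all that is used about `A`
  obtain ⟨hAK, hAm, hAX⟩ : (∀ t, 1 ≤ t → ∀ ω, A t ω ∈ K) ∧ (∀ t, 1 ≤ t → Measurable (A t)) ∧
      (∀ t, 1 ≤ t → ∀ ω, u' t (G.pivot (fun s => (U s ω : Euc n)) t) - u' t (A t ω)
        ≤ V * (1 + D / r) * G.radius t) := by
    rcases hA with hA | hA
    · have hA' : ∀ t ω, A t ω = G.played (fun s => (U s ω : Euc n)) t := fun t ω => by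
        simp only [hA, GoldData.played, hpiv]
        rfl
      refine ⟨fun t ht ω => ?_, fun t ht => ?_, fun t ht ω => ?_⟩
      · rw [hA']
        exact h.action_mem ht (h.pivot_mem _ t) (hw ω t)
      · rw [funext (hA' t)]
        exact h.measurable_played_comp hU ht
      · rw [hA']
        have := (abs_le.1 (h.abs_payoff_played_sub_le (hw ω) ht)).1
        change -(V * (1 + D / r) * G.radius t)
          ≤ u' t (G.played _ t) - u' t (G.pivot _ t) at this
        linarith
    · have hA' : ∀ t ω, A t ω = G.pivot (fun s => (U s ω : Euc n)) t := fun t ω => by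
        rw [hA]
        exact hpiv t ω
      refine ⟨fun t ht ω => ?_, fun t ht => ?_, fun t ht ω => ?_⟩
      · rw [hA']
        exact h.pivot_mem _ t
      · rw [funext (hA' t)]
        exact h.measurable_pivot_comp hU t
      · rw [hA', sub_self]
        have := h.radius_pos t ht
        positivity
  have hint' : ∀ t, 1 ≤ t → Integrable (fun ω => u' t (A t ω)) μ := fun t ht =>
    h.integrable_payoff_comp ht (hAm t ht)
  have hint : ∀ t, 1 ≤ t → Integrable (fun ω => u t (A t ω)) μ := fun t ht =>
    (hint' t ht).congr (.of_forall fun ω => huu' t _ (hAK t ht ω))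
  refine ⟨hint, fun T hT => ?_⟩
  have hgr := isGreatest_meanRegret hK ⟨x₁, hx₁⟩ (fun t ht => (hu t ht).continuousOn) hint T
  refine ⟨hgr, ?_⟩
  obtain ⟨x, hx, hxm⟩ := hgr.1
  rw [← hxm, expectedRegret_eq hint]
  have hpi : ∀ t, 1 ≤ t → Integrable (fun ω => u' t (G.pivot (fun s => (U s ω : Euc n)) t)) μ :=
    fun t ht => h.integrable_payoff_comp ht (h.measurable_pivot_comp hU t)
  -- Passing from pivots to `A` costs at most a multiple of the radius, which has the same order as
  -- the bias.
  have hterm : ∀ t ∈ Finset.Icc 1 T, u t x - ∫ ω, u t (A t ω) ∂μ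
      ≤ ∫ ω, (u' t x - u' t (G.pivot (fun s => (U s ω : Euc n)) t)) ∂μ
        + V * (1 + D / r) * G.radius t := fun t ht => by
    have ht1 := (Finset.mem_Icc.1 ht).1
    have e : ∫ ω, u t (A t ω) ∂μ = ∫ ω, u' t (A t ω) ∂μ :=
      integral_congr_ae (.of_forall fun ω => (huu' t _ (hAK t ht1 ω)).symm)
    have h1 : ∫ ω, (u' t (G.pivot (fun s => (U s ω : Euc n)) t) - u' t (A t ω)) ∂μ
        ≤ V * (1 + D / r) * G.radius t :=
      (integral_mono ((hpi t ht1).sub (hint' t ht1)) (integrable_const _)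
        (hAX t ht1)).trans_eq (by simp)
    rw [integral_sub (hpi t ht1) (hint' t ht1)] at h1
    rw [integral_sub (integrable_const _) (hpi t ht1), e, ← huu' t x hx]
    simp only [integral_const, probReal_univ, one_smul]
    linarith
  have hcore := h.sum_integral_payoff_sub_le hn hU hlaw hind hT hx
  have hrates := tuned_rates (N := n) (D := D) (r := r) (V := V) (B := B) (M := M) (γ := γ)
    (δ := δ) (m := maxDelay d) (by positivity) hD hr hV (by positivity) hM hγ hδ hA₀ hc0 hc1 hac
    hmax hT
  have hstep : ∀ t, G.step t = γ / (t : ℝ) ^ c := fun t => rfl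
  have hradius : ∀ t, G.radius t = δ / (t : ℝ) ^ (1 - c) := fun t => by
    rw [hc, ← min_eq_one_sub_max]
    rfl
  have hpow : (T : ℝ) ^ c ≤ (T : ℝ) ^ (3 / 4 : ℝ) + (T : ℝ) ^ (2 / 3 + α / 3) := by
    have h1 : (0 : ℝ) ≤ (T : ℝ) ^ (3 / 4 : ℝ) := by positivity
    have h2 : (0 : ℝ) ≤ (T : ℝ) ^ (2 / 3 + α / 3) := by positivity
    rcases max_choice (3 / 4 : ℝ) (2 / 3 + α / 3) with he | he <;> rw [hc, he] <;> linarith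
  rw [pow_zero, mul_one]
  refine le_trans ?_ (mul_le_mul_of_nonneg_left hpow (by positivity))
  refine le_trans ((Finset.sum_le_sum hterm).trans_eq Finset.sum_add_distrib) (le_trans ?_ hrates)
  simp only [hstep, hradius] at hcore ⊢
  exact add_le_add_left hcore _
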